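/- Let $d\ge 1$, let $\mathrm{Sym}_d$ be the symmetric group on $\{1,\dots,d\}$ (permutations composed from right to left), let $\delta=(1\ 2\ \cdots\ d)$, and let $\ell(h)$ be the least number of transpositions with product $h\in\mathrm{Sym}_d$. Write $h\le g$ if $\ell(h)+\ell(h^{-1}g)=\ell(g)$, and $[1,\delta]=\{h : h\le\delta\}$. Let $\mathbf I=[0,1]$ and let $\mathbf S\subset\mathbb C$ be the unit circle. For a set $S$, let $\mathrm{Mult}(\mathrm{Sym}_d,S)$ be the set of functions $u\colon S\to\mathrm{Sym}_d$ that are trivial at all but finitely many points. Let $\mathcal F(\mathrm{Sym}_d,\delta,\mathbf I)$ be the set of all $u\in\mathrm{Mult}(\mathrm{Sym}_d,\mathbf I)$, written $u=0^{x_L}s_1^{x_1}\cdots s_k^{x_k}1^{x_R}$ with $0<s_1<\cdots<s_k<1$ the points of $(0,1)$ at which $u$ is nontrivial and $x_L=u(0)$, $x_i=u(s_i)$, $x_R=u(1)$, such that $h=x_Lx_1\cdots x_kx_R$ lies in $[1,\delta]$ and $\ell(x_L)+\ell(x_1)+\cdots+\ell(x_k)+\ell(x_R)=\ell(h)$; order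 it by $v\subseteq u$ if $v(r)\le u(r)$ for all $r\in\mathbf I$. Let $\mathcal F(\mathrm{Sym}_d,\delta,\mathbf S)$ be the quotient of this set in which $u$ and $v$ are identified when they agree on $(0,1)$ and $\delta u(1)\delta^{-1}u(0)=\delta v(1)\delta^{-1}v(0)$, ordered by $[v]\le[u]$ if $v'\subseteq u'$ for some representatives $v'\in[v]$, $u'\in[u]$. The class of $0^{x_L}s_1^{x_1}\cdots s_k^{x_k}1^{x_R}$ is regarded as the element $0^{h}s_1^{x_1}\cdots s_k^{x_k}1^{1}$ of $\mathrm{Mult}(\mathrm{Sym}_d,\mathbf S)$, with $h=\delta x_R\delta^{-1}x_L$, that takes the value $h$ at $1\in\mathbf S$, the value $x_i$ at $e^{2\pi i s_i}$, and the value $1$ elsewhere. Let $\Pi_d(\mathbf S)$ be the set of partitions of $\mathbf S$ such that $z^d=w^d$ whenever $z,w$ are in the same block, ordered by refinement (finer partitions are smaller), and let $NC_d(\mathbf S)$ be the subposet of those whose blocks have pairwise disjoint convex hulls in $\mathbb C$. For $s\in[0,1)$, identify the fiber $\{z : z^d=e^{2\pi i s}\}$ with $\{1,\dots,d\}$ by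 listing its points in increasing order of argument in $[0,2\pi)$. Define $\Psi\colon\mathrm{Mult}(\mathrm{Sym}_d,\mathbf S)\to\Pi_d(\mathbf S)$ by letting $\Psi(u)$ be the partition whose restriction to the fiber over $e^{2\pi i s}$ is, for every $s\in[0,1)$, the partition $\psi(u(e^{2\pi i s}))$ of $\{1,\dots,d\}$ into the orbits of the permutation $u(e^{2\pi i s})$. Then $\Psi$ restricts to an isomorphism of posets from $\mathcal F(\mathrm{Sym}_d,\delta,\mathbf S)$ onto $NC_d(\mathbf S)$. -/

import Mathlib

/-! Conventions: permutations are composed from right to left; a group `G` is marked by a set `X`. -/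

section Marked

variable {G : Type*} [Group G]

/-- The length of `h` over `X`: the least length of a word over `X` with product `h`
(only meaningful for `h` in the submonoid generated by `X`). -/
noncomputable def wordLength (X : Set G) (h : G) : ℕ :=
  sInf {n | ∃ l : List G, (∀ x ∈ l, x ∈ X) ∧ l.prod = h ∧ l.length = n}

/-- The prefix order: `h ≤ g` if `h * h' = g` with `ℓ(h) + ℓ(h') = ℓ(g)`, all in the submonoid
generated by `X`. -/
def PrefixLE (X : Set G) (h g : G) : Prop :=
  ∃ h' : G, h ∈ Submonoid.closure X ∧ h' ∈ Submonoid.closure X ∧ h * h' = g ∧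
    wordLength X h + wordLength X h' = wordLength X g

/-- The interval `[1, g]` for the prefix order. -/
def prefixInterval (X : Set G) (g : G) : Set G :=
  {h | PrefixLE X 1 h ∧ PrefixLE X h g}

/-- A row vector `[x_L x_1 ⋯ x_k x_R]`. -/
structure FactVector (G : Type*) where
  left : G
  mid : List G
  right : G

/-- The list of all entries of a row vector, from left to right. -/
def FactVector.entries (x : FactVector G) : List G := x.left :: (x.mid ++ [x.right])

/-- Linear factorizations of `g`: entries in the submonoid generated by `X`, nontrivial in the
middle, with lengths adding up to `ℓ(g)` and product `g`. -/
structure IsLinearFactorization (X : Set G) (g : G) (x : FactVector G) : Prop where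
  mem_closure : ∀ y ∈ x.entries, y ∈ Submonoid.closure X
  mid_ne_one : ∀ y ∈ x.mid, y ≠ 1
  sum_length : (x.entries.map (wordLength X)).sum = wordLength X g
  prod_eq : x.entries.prod = g

end Marked

/-- `G`-multisets on `S`: functions `S → G` that are trivial at all but finitely many points. -/
def GMultiset (S G : Type*) [Group G] : Type _ :=
  {u : S → G // (Function.mulSupport u).Finite}

section Marked

variable {G : Type*} [Group G]

/-- The points `s_1, …, s_k` of the open interval `(0, 1)` at which `u` is nontrivial. -/
noncomputable def GMultiset.innerSupport (u : GMultiset unitInterval G) : Finset unitInterval :=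
  u.2.toFinset.filter (fun r => 0 < r ∧ r < 1)

/-- The row vector `[u(0) u(s_1) ⋯ u(s_k) u(1)]` with `s_1 < ⋯ < s_k`. -/
noncomputable def GMultiset.factVector (u : GMultiset unitInterval G) : FactVector G where
  left := u.1 0
  mid := (u.innerSupport.sort (· ≤ ·)).map u.1
  right := u.1 1

/-- Weighted linear factorizations of `h`. -/
def weightedFactorizations (X : Set G) (h : G) : Set (GMultiset unitInterval G) :=
  {u | IsLinearFactorization X h u.factVector}

/-- The linear poset `F(G, g, I)`: the union over `h ∈ [1, g]` of the weighted linear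
factorizations of `h`; it is a disjoint union because `u` determines the product `h`. -/
def LinearFactPoset (X : Set G) (g : G) : Type _ :=
  {u : GMultiset unitInterval G // ∃ h ∈ prefixInterval X g, u ∈ weightedFactorizations X h}

/-- The value of a `G`-multiset on the interval at the point `r`. -/
def LinearFactPoset.val {X : Set G} {g : G} (u : LinearFactPoset X g) (r : unitInterval) : G :=
  u.1.1 r

/-- The subfactorization order on `F(G, g, I)`. -/
instance (X : Set G) (g : G) : LE (LinearFactPoset X g) :=
  ⟨fun v u => ∀ r, PrefixLE X (v.val r) (u.val r)⟩

/-- The identification `0^{x_L} s_1^{x_1} ⋯ s_k^{x_k} 1^{x_R} ∼ 0^{y_L} s_1^{x_1} ⋯ s_k^{x_k} 1^{y_R}`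
if `g x_R g⁻¹ x_L = g y_R g⁻¹ y_L`. -/
def circularSetoid (X : Set G) (g : G) : Setoid (LinearFactPoset X g) where
  r u v := (∀ r : unitInterval, 0 < r → r < 1 → u.val r = v.val r) ∧
    g * u.val 1 * g⁻¹ * u.val 0 = g * v.val 1 * g⁻¹ * v.val 0
  iseqv :=
    { refl := fun _ => ⟨fun _ _ _ => rfl, rfl⟩
      symm := fun h => ⟨fun r h0 h1 => (h.1 r h0 h1).symm, h.2.symm⟩
      trans := fun h k => ⟨fun r h0 h1 => (h.1 r h0 h1).trans (k.1 r h0 h1), h.2.trans k.2⟩ }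

/-- The circular poset `F(G, g, S)`, a quotient of `F(G, g, I)`. -/
def CircularFactPoset (X : Set G) (g : G) : Type _ := Quotient (circularSetoid X g)

/-- The order on `F(G, g, S)` inherited from `F(G, g, I)`: some representatives are related. -/
instance (X : Set G) (g : G) : LE (CircularFactPoset X g) :=
  ⟨fun a b => ∃ v u : LinearFactPoset X g, Quotient.mk (circularSetoid X g) v = a ∧
    Quotient.mk (circularSetoid X g) u = b ∧ v ≤ u⟩

end Marked

/-- The number `s ∈ [0, 1)` with `z = e^{2 π i s}`. -/
noncomputable def circleParam (z : Circle) : ℝ := Int.fract (Complex.arg z / (2 * Real.pi))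

theorem circleParam_mem (z : Circle) : circleParam z ∈ Set.Ico (0 : ℝ) 1 :=
  ⟨Int.fract_nonneg _, Int.fract_lt_one _⟩

theorem exp_circleParam (z : Circle) : Circle.exp (2 * Real.pi * circleParam z) = z := by
  have hpi : (2 * Real.pi) ≠ 0 := by positivity
  have h : 2 * Real.pi * circleParam z =
      Complex.arg z - ⌊Complex.arg z / (2 * Real.pi)⌋ * (2 * Real.pi) := by
    unfold circleParam Int.fract
    field_simp
  rw [h, Circle.periodic_exp.sub_int_mul_eq]
  exact Circle.exp_arg z

/-- The number `s ∈ [0, 1)` with `z = e^{2 π i s}`, as a point of the unit interval. -/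
noncomputable def circleParamI (z : Circle) : unitInterval :=
  ⟨circleParam z, (circleParam_mem z).1, (circleParam_mem z).2.le⟩

section Marked

variable {G : Type*} [Group G]

open Classical in
/-- The values on the circle of the representative `0^h s_1^{x_1} ⋯ s_k^{x_k} 1^1`,
where `h = g x_R g⁻¹ x_L`. -/
noncomputable def LinearFactPoset.circleFun {X : Set G} {g : G} (u : LinearFactPoset X g)
    (z : Circle) : G :=
  if z = 1 then g * u.val 1 * g⁻¹ * u.val 0 else u.val (circleParamI z)

theorem circleParam_pos {z : Circle} (hz : z ≠ 1) : 0 < circleParam z := by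
  refine lt_of_le_of_ne (circleParam_mem z).1 fun h => hz ?_
  rw [← exp_circleParam z, ← h]
  simp

theorem LinearFactPoset.circleFun_finite {X : Set G} {g : G} (u : LinearFactPoset X g) :
    (Function.mulSupport u.circleFun).Finite := by
  refine ((u.1.2.image fun r : unitInterval => Circle.exp (2 * Real.pi * r)).union
    (Set.finite_singleton 1)).subset fun z hz => ?_
  by_cases h1 : z = 1
  · exact Or.inr h1
  · refine Or.inl ⟨circleParamI z, ?_, exp_circleParam z⟩
    simpa [LinearFactPoset.circleFun, h1, LinearFactPoset.val] using hz

/-- An element of `F(G, g, S)` viewed as a `G`-multiset on the circle, through its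
representative that is trivial at the right endpoint of the interval. -/
noncomputable def CircularFactPoset.toMultiset {X : Set G} {g : G} :
    CircularFactPoset X g → GMultiset Circle G :=
  Quotient.lift (fun u => ⟨u.circleFun, u.circleFun_finite⟩) (by
    intro u v h
    refine Subtype.ext (funext fun z => ?_)
    by_cases h1 : z = 1
    · simpa [LinearFactPoset.circleFun, h1] using h.2
    · simpa [LinearFactPoset.circleFun, h1] using
        h.1 (circleParamI z) (circleParam_pos h1) (circleParam_mem z).2)

end Marked

/-- A partition of the unit circle is noncrossing if the convex hulls of its blocks in `ℂ` are
pairwise disjoint. -/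
def IsNoncrossing (π : Setoid Circle) : Prop :=
  π.classes.Pairwise fun A B =>
    Disjoint (convexHull ℝ ((fun z : Circle => (z : ℂ)) '' A))
      (convexHull ℝ ((fun z : Circle => (z : ℂ)) '' B))

/-- Degree-`d` partitions of the circle, ordered by refinement (finer is smaller). -/
abbrev DegreePartition (d : ℕ) : Type :=
  {π : Setoid Circle // ∀ z w, π z w → z ^ d = w ^ d}

/-- Degree-`d` noncrossing partitions of the circle, ordered by refinement. -/
abbrev NCCircle (d : ℕ) : Type := {π : DegreePartition d // IsNoncrossing π.1}

/-- The position of `z` among the `d` solutions `w` of `w ^ d = z ^ d`, listed by increasing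
argument in `[0, 2π)`: if `z = e^{2 π i (s + m) / d}` with `0 ≤ s < 1`, `0 ≤ m < d`, it is `m`. -/
noncomputable def fiberLabel (d : ℕ) [NeZero d] (z : Circle) : Fin d :=
  ⟨⌊(d : ℝ) * circleParam z⌋₊, by
    have hd : (0 : ℝ) < d := by exact_mod_cast Nat.pos_of_ne_zero (NeZero.ne d)
    rw [Nat.floor_lt (mul_nonneg hd.le (circleParam_mem z).1)]
    nlinarith [(circleParam_mem z).2]⟩

/-- The degree-`d` partition of the circle which restricts, on each fiber `{z | z ^ d = s}`
(identified with `Fin d`), to the given partition `p s`. -/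
noncomputable def assemblePartition (d : ℕ) [NeZero d] (p : Circle → Setoid (Fin d)) :
    DegreePartition d :=
  ⟨{ r := fun z w => z ^ d = w ^ d ∧ p (z ^ d) (fiberLabel d z) (fiberLabel d w)
     iseqv :=
      { refl := fun _ => ⟨rfl, Setoid.refl' _ _⟩
        symm := fun h => ⟨h.1.symm, h.1 ▸ Setoid.symm' _ h.2⟩
        trans := fun {a b c} h k =>
          ⟨h.1.trans k.1, Setoid.trans' _ h.2 (by rw [h.1]; exact k.2)⟩ } },
    fun _ _ h => h.1⟩

/-- The partition of `{1, …, d}` (here `Fin d`) into the orbits of a permutation. -/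
def orbitPartition {d : ℕ} (σ : Equiv.Perm (Fin d)) : Setoid (Fin d) :=
  Equiv.Perm.SameCycle.setoid σ

/-- The map `Ψ` from `Sym_d`-multisets on the circle to degree-`d` partitions. -/
noncomputable def Psi (d : ℕ) [NeZero d] (u : GMultiset Circle (Equiv.Perm (Fin d))) :
    DegreePartition d :=
  assemblePartition d fun s => orbitPartition (u.1 s)

/-- The set of all transpositions in `Sym_d`. -/
def transpositions (d : ℕ) : Set (Equiv.Perm (Fin d)) := {σ | σ.IsSwap}

/-!
The group `Sym_d` enters through one numerical fact: the length `ℓ(σ)` is `d` minus the number of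
orbits of `σ` (`refLength_add_classCount`). It follows that the factors of a product with additive
lengths have orbits inside those of the product (`orbitPartition_le_mul`).

Read `(m, s)`, with `m ∈ Fin d` and `s ∈ [0, 1)`, as the point `e^{2πi(m+s)/d}` of the circle; it has
label `m` in the fiber over `e^{2πis}`, and arguments are ordered lexicographically in `(m, s)`. A
multiset `s ↦ u s` permutes all these points fiber by fiber. The combinatorial core is that
`∏ u s`, in increasing order of `s`, is a prefix of `δ` with lengths adding up if and only if each
`u s` is cyclically increasing on its orbits and each interval of the circle from a point `(a, r)`
up to its image `(u r a, r)` is invariant under all the `u s` (`ArcInvariant`).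

* If the lengths add up, a factor `x = u r` with `b = x a > a` may be split as `(a b) x'`, and then `x'`
  and all the later factors lie below `(a b) δ`, which preserves the interval `[a, b)`; the earlier
  factors lie below `δ (a b)`, which preserves `(a, b]`. See `arcInvariant_of_reduced`.
* Conversely, let `K = (∏ u s)⁻¹ δ`. For each ascent `a < u r a` the interval `[a, u r a)` is
  invariant under `K`, and it contains the representative of this ascent but of no earlier one. So
  `K` has more orbits than the family has ascents, and a cyclically increasing `σ` has `ℓ(σ)`
  ascents. See `ArcInvariant.sum_refLength_le`, which is stated with any cyclically increasing `y` in
  place of `δ`: with a single factor it also shows that refinement of orbits gives the prefix order.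

Arc invariance is the same as the absence of crossings among the orbits
(`ArcInvariant.noncrossingFamily`, `NoncrossingFamily.arcInvariant`), and crossings are detected by
convex hulls (`isNoncrossing_iff`): two chords with interleaved endpoints meet, and a block in a gap
of another one is separated from it by the line through the ends of the gap. Finally, a cyclically
increasing permutation is determined by its orbits, which can be any partition, so that `Ψ` is
bijective. That a noncrossing partition has only finitely many nontrivial fibers follows from the
bound on the sum of the lengths.
-/

/-! ### Orbits and the length of a permutation -/

open Equiv.Perm in
theorem orbitPartition_le {d : ℕ} {σ : Equiv.Perm (Fin d)} {r : Setoid (Fin d)}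
    (h : ∀ a, r a (σ a)) : orbitPartition σ ≤ r := by
  have hn : ∀ (n : ℕ) a, r a ((σ ^ n) a) := by
    intro n
    induction n with
    | zero => intro a; exact r.refl' a
    | succ n ih => intro a; rw [pow_succ']; exact r.trans' (ih a) (h _)
  intro a b hab
  obtain ⟨n, hn'⟩ := (show SameCycle σ a b from hab).exists_nat_pow_eq
  exact hn' ▸ hn n a

theorem mem_of_orbitPartition {d : ℕ} {σ : Equiv.Perm (Fin d)} {I : Set (Fin d)}
    (hI : ∀ m ∈ I, σ m ∈ I) {a b : Fin d} (hab : orbitPartition σ a b) (ha : a ∈ I) : b ∈ I := by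
  obtain ⟨n, rfl⟩ := Equiv.Perm.SameCycle.exists_nat_pow_eq hab
  clear hab
  induction n with
  | zero => exact ha
  | succ n ih => rw [pow_succ']; exact hI _ ih

theorem list_prod_rel {d : ℕ} {r : Setoid (Fin d)} {l : List (Equiv.Perm (Fin d))}
    (h : ∀ t ∈ l, ∀ a, r a (t a)) (a : Fin d) : r a (l.prod a) := by
  induction l with
  | nil => exact r.refl' a
  | cons t l ih =>
    rw [List.prod_cons, Equiv.Perm.mul_apply]
    exact r.trans' (ih fun t' ht' => h t' (List.mem_cons_of_mem _ ht')) (h t List.mem_cons_self _)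

theorem orbitPartition_apply {d : ℕ} (σ : Equiv.Perm (Fin d)) (a : Fin d) :
    orbitPartition σ a (σ a) :=
  Equiv.Perm.sameCycle_apply_right.2 (Equiv.Perm.SameCycle.refl σ a)

/-- The number of classes of a partition of `Fin d`. -/
noncomputable def classCount {d : ℕ} (r : Setoid (Fin d)) : ℕ := Nat.card (Quotient r)

theorem classCount_le {d : ℕ} (r : Setoid (Fin d)) : classCount r ≤ d :=
  (Nat.card_le_card_of_surjective _ Quotient.mk_surjective).trans_eq (by simp)

theorem classCount_le_of_le {d : ℕ} {r s : Setoid (Fin d)} (h : r ≤ s) :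
    classCount s ≤ classCount r :=
  Nat.card_le_card_of_surjective (Quotient.map' id h) fun q =>
    Quotient.inductionOn' q fun a => ⟨Quotient.mk'' a, rfl⟩

theorem eq_of_le_of_classCount_le {d : ℕ} {r s : Setoid (Fin d)} (h : r ≤ s)
    (hc : classCount r ≤ classCount s) : r = s := by
  have hsurj : Function.Surjective (Quotient.map' (s₁ := r) (s₂ := s) id h) := fun q =>
    Quotient.inductionOn' q fun a => ⟨Quotient.mk'' a, rfl⟩
  have hb := hsurj.bijective_of_nat_card_le hc
  refine le_antisymm h fun a b hab => ?_
  exact Quotient.exact (hb.1 (a₁ := Quotient.mk'' a) (a₂ := Quotient.mk'' b)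
    (Quotient.sound hab))

/-- Each transposition merges at most two classes. -/
theorem exists_setoid_of_swaps {d : ℕ} (l : List (Equiv.Perm (Fin d)))
    (hl : ∀ t ∈ l, t ∈ transpositions d) :
    ∃ r : Setoid (Fin d), (∀ t ∈ l, ∀ a, r a (t a)) ∧ d ≤ classCount r + l.length := by
  classical
  induction l with
  | nil =>
    refine ⟨⊥, by simp, ?_⟩
    have : classCount (⊥ : Setoid (Fin d)) = d := by
      have := Nat.card_eq_of_bijective (Quotient.mk (⊥ : Setoid (Fin d)))
        ⟨fun a b h => Quotient.exact h, Quotient.mk_surjective⟩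
      rw [classCount, ← this]; simp
    simp [this]
  | cons t l ih =>
    obtain ⟨r, hr, hc⟩ := ih fun t' ht' => hl t' (List.mem_cons_of_mem _ ht')
    obtain ⟨a, b, hab, rfl⟩ := hl t List.mem_cons_self
    let g : Quotient r → Quotient r := fun q => if q = Quotient.mk r a then Quotient.mk r b else q
    let f : Fin d → Quotient r := fun x => g (Quotient.mk r x)
    have hle : r ≤ Setoid.ker f := fun x y hxy => by
      change g _ = g _
      rw [Quotient.sound hxy]
    refine ⟨Setoid.ker f, ?_, ?_⟩
    · intro t' ht' x
      rcases List.mem_cons.1 ht' with rfl | ht'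
      · change f x = f (Equiv.swap a b x)
        have hfab : f a = f b := by
          simp only [f, g]
          split_ifs <;> simp_all
        by_cases hxa : x = a
        · subst hxa; simpa using hfab
        by_cases hxb : x = b
        · subst hxb; simpa using hfab.symm
        rw [Equiv.swap_apply_of_ne_of_ne hxa hxb]
      · exact hle (hr t' ht' x)
    · have : Nat.card (Quotient r) ≤ Nat.card (Quotient (Setoid.ker f)) + 1 := by
        have hinj : Function.Injective (fun q : Quotient r =>
            if q = Quotient.mk r a then none
            else some (Quotient.map' (s₂ := Setoid.ker f) id hle q)) := by
          intro q q' hq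
          induction q using Quotient.inductionOn with | _ x
          induction q' using Quotient.inductionOn with | _ y
          by_cases hx : (Quotient.mk r x) = Quotient.mk r a <;>
            by_cases hy : (Quotient.mk r y) = Quotient.mk r a
          · rw [hx, hy]
          · simp [hx, hy] at hq
          · simp [hx, hy] at hq
          · simp only [hx, hy, if_false, Option.some.injEq] at hq
            have h3 : f x = f y := Quotient.exact hq
            simpa [f, g, hx, hy] using h3
        have := Nat.card_le_card_of_injective _ hinj
        rwa [Finite.card_option] at this
      unfold classCount at *
      simp only [List.length_cons]
      omega

/-- The word length with respect to transpositions. -/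
noncomputable abbrev refLength {d : ℕ} (σ : Equiv.Perm (Fin d)) : ℕ :=
  wordLength (transpositions d) σ

theorem closure_transpositions (d : ℕ) : Submonoid.closure (transpositions d) = ⊤ :=
  Equiv.Perm.mclosure_isSwap

theorem refLength_le {d : ℕ} {l : List (Equiv.Perm (Fin d))} (hl : ∀ t ∈ l, t ∈ transpositions d) :
    refLength l.prod ≤ l.length :=
  Nat.sInf_le ⟨l, hl, rfl, rfl⟩

theorem exists_reduced_word {d : ℕ} (σ : Equiv.Perm (Fin d)) :
    ∃ l : List (Equiv.Perm (Fin d)), (∀ t ∈ l, t ∈ transpositions d) ∧ l.prod = σ ∧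
      l.length = refLength σ := by
  have hne : {n | ∃ l : List (Equiv.Perm (Fin d)), (∀ x ∈ l, x ∈ transpositions d) ∧
      l.prod = σ ∧ l.length = n}.Nonempty := by
    have hσ : σ ∈ Submonoid.closure (transpositions d) := by simp [closure_transpositions]
    obtain ⟨l, hl, hp⟩ := Submonoid.exists_list_of_mem_closure hσ
    exact ⟨_, l, hl, hp, rfl⟩
  exact Nat.sInf_mem hne

theorem refLength_mul_le {d : ℕ} (σ τ : Equiv.Perm (Fin d)) :
    refLength (σ * τ) ≤ refLength σ + refLength τ := by
  obtain ⟨l, hl, rfl, hlen⟩ := exists_reduced_word σ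
  obtain ⟨l', hl', rfl, hlen'⟩ := exists_reduced_word τ
  rw [← hlen, ← hlen', ← List.prod_append, ← List.length_append]
  exact refLength_le fun t ht => (List.mem_append.1 ht).elim (hl t) (hl' t)

theorem refLength_one {d : ℕ} : refLength (1 : Equiv.Perm (Fin d)) = 0 :=
  Nat.le_zero.1 (refLength_le (l := []) (by simp))

theorem refLength_swap_le {d : ℕ} {a b : Fin d} (h : a ≠ b) : refLength (Equiv.swap a b) ≤ 1 := by
  simpa using refLength_le (l := [Equiv.swap a b]) (by simpa using ⟨a, b, h, rfl⟩)

theorem refLength_conj_le {d : ℕ} (σ τ : Equiv.Perm (Fin d)) :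
    refLength (τ * σ * τ⁻¹) ≤ refLength σ := by
  obtain ⟨l, hl, rfl, hlen⟩ := exists_reduced_word σ
  have h := refLength_le (l := l.map (MulAut.conj τ)) (by
    intro t ht
    obtain ⟨t', ht', rfl⟩ := List.mem_map.1 ht
    obtain ⟨a, b, hab, rfl⟩ := hl t' ht'
    refine ⟨τ a, τ b, τ.injective.ne hab, ?_⟩
    ext x
    simp [MulAut.conj_apply, Equiv.swap_apply_apply])
  rw [← map_list_prod, List.length_map, hlen] at h
  simpa using h

theorem refLength_conj {d : ℕ} (σ τ : Equiv.Perm (Fin d)) :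
    refLength (τ * σ * τ⁻¹) = refLength σ := by
  refine le_antisymm (refLength_conj_le σ τ) ?_
  simpa [mul_assoc] using refLength_conj_le (τ * σ * τ⁻¹) τ⁻¹

/-- Multiplying by `(a σ(a))` on the left makes `a` a fixed point and keeps all other orbits inside
those of `σ`. -/
theorem classCount_swap_mul {d : ℕ} {σ : Equiv.Perm (Fin d)} {a : Fin d} (h : σ a ≠ a) :
    classCount (orbitPartition σ) < classCount (orbitPartition (Equiv.swap a (σ a) * σ)) := by
  have hle : orbitPartition (Equiv.swap a (σ a) * σ) ≤ orbitPartition σ := by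
    refine orbitPartition_le fun x => ?_
    have hs : ∀ y, orbitPartition σ y (Equiv.swap a (σ a) y) := by
      intro y
      by_cases hya : y = a
      · subst hya; simpa using orbitPartition_apply σ y
      by_cases hyb : y = σ a
      · subst hyb; simpa using Setoid.symm' _ (orbitPartition_apply σ a)
      rw [Equiv.swap_apply_of_ne_of_ne hya hyb]
    exact Setoid.trans' _ (orbitPartition_apply σ x) (hs _)
  by_contra hlt
  have heq := eq_of_le_of_classCount_le hle (not_lt.1 (by simpa using hlt) )
  have h1 : orbitPartition (Equiv.swap a (σ a) * σ) a (σ a) := heq ▸ orbitPartition_apply σ a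
  have hfix : (Equiv.swap a (σ a) * σ) a = a := by simp
  exact h ((Equiv.Perm.SameCycle.eq_of_left
    (show Equiv.Perm.SameCycle _ a (σ a) from h1) hfix).symm)

/-- The least number of transpositions with product `σ` is `d` minus the number of orbits. -/
theorem refLength_add_classCount {d : ℕ} (σ : Equiv.Perm (Fin d)) :
    refLength σ + classCount (orbitPartition σ) = d := by
  apply le_antisymm
  · have key : ∀ (n : ℕ) (σ : Equiv.Perm (Fin d)), d ≤ classCount (orbitPartition σ) + n →
        refLength σ + classCount (orbitPartition σ) ≤ d := by
      intro n
      induction n with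
      | zero =>
        intro σ hn
        by_cases hσ : ∃ a, σ a ≠ a
        · obtain ⟨a, ha⟩ := hσ
          have h1 := classCount_swap_mul ha
          have h2 := classCount_le (orbitPartition (Equiv.swap a (σ a) * σ))
          omega
        · have : σ = 1 := Equiv.ext fun a => by simpa using not_exists.1 hσ a
          rw [this, refLength_one, zero_add, ← this]
          exact classCount_le _
      | succ n ih =>
        intro σ hn
        by_cases hσ : ∃ a, σ a ≠ a
        · obtain ⟨a, ha⟩ := hσ
          have h1 := classCount_swap_mul ha
          have h2 := ih (Equiv.swap a (σ a) * σ) (by omega)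
          have h3 := refLength_mul_le (Equiv.swap a (σ a)) (Equiv.swap a (σ a) * σ)
          rw [← mul_assoc, Equiv.swap_mul_self, one_mul] at h3
          have h4 := refLength_swap_le ha.symm
          omega
        · have : σ = 1 := Equiv.ext fun a => by simpa using not_exists.1 hσ a
          rw [this, refLength_one, zero_add, ← this]
          exact classCount_le _
    exact key d σ (Nat.le_add_left _ _)
  · obtain ⟨l, hl, rfl, hlen⟩ := exists_reduced_word σ
    obtain ⟨r, hr, hc⟩ := exists_setoid_of_swaps l hl
    have := classCount_le_of_le (orbitPartition_le fun a => list_prod_rel hr a)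
    omega

/-- The transpositions in a reduced word of `σ` move points only inside the orbits of `σ`: the
finest partition they all preserve has as many classes as `σ` has orbits. -/
theorem orbitPartition_le_mul {d : ℕ} {σ τ : Equiv.Perm (Fin d)}
    (h : refLength σ + refLength τ ≤ refLength (σ * τ)) :
    orbitPartition σ ≤ orbitPartition (σ * τ) ∧ orbitPartition τ ≤ orbitPartition (σ * τ) := by
  obtain ⟨l, hl, rfl, hlen⟩ := exists_reduced_word σ
  obtain ⟨l', hl', rfl, hlen'⟩ := exists_reduced_word τ
  obtain ⟨r, hr, hc⟩ := exists_setoid_of_swaps (l ++ l')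
    fun t ht => (List.mem_append.1 ht).elim (hl t) (hl' t)
  have hle : orbitPartition (l.prod * l'.prod) ≤ r :=
    orbitPartition_le fun a => List.prod_append (l₁ := l) (l₂ := l') ▸ list_prod_rel hr a
  have h1 := refLength_add_classCount (l.prod * l'.prod)
  rw [List.length_append] at hc
  have heq := eq_of_le_of_classCount_le hle (by omega)
  rw [heq]
  exact ⟨orbitPartition_le fun a => list_prod_rel (fun t ht => hr t (List.mem_append_left _ ht)) a,
    orbitPartition_le fun a => list_prod_rel (fun t ht => hr t (List.mem_append_right _ ht)) a⟩

/-! ### Cyclically increasing permutations and the counting of orbits -/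

theorem perm_apply_inv {α : Type*} (σ : Equiv.Perm α) (a : α) : σ (σ⁻¹ a) = a :=
  σ.apply_symm_apply a

/-- A permutation is cyclically increasing if, on each orbit, it sends every element but the largest
to the next larger element of the orbit. -/
def CyclicallyIncreasing {d : ℕ} (σ : Equiv.Perm (Fin d)) : Prop :=
  ∀ a b, orbitPartition σ a b → a < b → a < σ a ∧ σ a ≤ b

theorem CyclicallyIncreasing.eq_of_orbitPartition_eq {d : ℕ} {σ τ : Equiv.Perm (Fin d)}
    (hσ : CyclicallyIncreasing σ) (hτ : CyclicallyIncreasing τ)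
    (h : orbitPartition σ = orbitPartition τ) : σ = τ := by
  have up : ∀ {σ τ : Equiv.Perm (Fin d)}, CyclicallyIncreasing σ → CyclicallyIncreasing τ →
      orbitPartition σ = orbitPartition τ → ∀ a, a < σ a → τ a = σ a := by
    intro σ τ hσ hτ h a ha
    have h1 := hτ a (σ a) (h ▸ orbitPartition_apply σ a) ha
    exact le_antisymm h1.2 (hσ a (τ a) (h ▸ orbitPartition_apply τ a) h1.1).2
  ext1 a
  by_cases h1 : a < σ a
  · exact (up hσ hτ h a h1).symm
  by_cases h2 : a < τ a
  · exact up hτ hσ h.symm a h2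
  -- now `a` is the largest element of its orbit, and `σ a`, `τ a` are the smallest one
  have low : ∀ {σ : Equiv.Perm (Fin d)}, CyclicallyIncreasing σ → ¬ a < σ a →
      ∀ b, orbitPartition σ a b → σ a ≤ b := by
    intro σ hσ hna b hab
    by_contra hlt
    have hmax : ∀ c, orbitPartition σ a c → c ≤ a := fun c hc =>
      not_lt.1 fun hac => hna (hσ a c hc hac).1
    obtain ⟨c, hc, hcmin⟩ := (Set.toFinite {c | orbitPartition σ a c}).exists_minimal ⟨b, hab⟩
    have hcb : ∀ e, orbitPartition σ a e → c ≤ e := fun e he => by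
      by_contra hce
      exact hce (hcmin he (not_le.1 hce).le)
    have hc' : orbitPartition σ a (σ⁻¹ c) :=
      Equiv.Perm.sameCycle_symm_apply_right.2 hc
    have hne : σ⁻¹ c ≠ a := by
      rintro h'
      have : σ a = c := by rw [← h']; simp
      exact hlt (this ▸ hcb b hab)
    have hlt' : σ⁻¹ c < a := lt_of_le_of_ne (hmax _ hc') hne
    have := (hσ (σ⁻¹ c) a (Setoid.symm' _ hc') hlt').1
    rw [perm_apply_inv] at this
    exact absurd (hcb _ hc') (not_le.2 this)
  exact le_antisymm (low hσ h1 _ (h ▸ orbitPartition_apply τ a))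
    (low hτ h2 _ (h ▸ orbitPartition_apply σ a))

/-- Each orbit of a cyclically increasing permutation has exactly one element that is not moved
up. -/
theorem CyclicallyIncreasing.le_card_ascents {d : ℕ} {σ : Equiv.Perm (Fin d)}
    (hσ : CyclicallyIncreasing σ) :
    d ≤ Nat.card {a // a < σ a} + classCount (orbitPartition σ) := by
  classical
  have h1 : Nat.card {a // ¬ a < σ a} ≤ classCount (orbitPartition σ) := by
    refine Nat.card_le_card_of_injective
      (fun a : {a // ¬ a < σ a} => Quotient.mk (orbitPartition σ) a.1) ?_
    rintro ⟨a, ha⟩ ⟨b, hb⟩ hab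
    have hab' : orbitPartition σ a b := Quotient.exact hab
    rcases lt_trichotomy a b with h | h | h
    · exact absurd (hσ a b hab' h).1 ha
    · exact Subtype.ext h
    · exact absurd (hσ b a (Setoid.symm' _ hab') h).1 hb
  have h2 : Nat.card {a // a < σ a} + Nat.card {a // ¬ a < σ a} = d := by
    rw [← Nat.card_sum, Nat.card_congr (Equiv.sumCompl fun a => a < σ a), Nat.card_fin]
  omega

/-- A family of permutations indexed by a linear order, thought of as acting on the points `(m, s)`
in lexicographic order, one copy of `Fin d` for each index `s`, satisfies this condition if each
open interval from a point `(a, r)` up to its image `(u r a, r)` is invariant under all of them. -/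
structure ArcInvariant {d : ℕ} {ι : Type*} [LinearOrder ι] (u : ι → Equiv.Perm (Fin d)) : Prop where
  after : ∀ r s a, a < u r a → r < s → ∀ m, u s m ∈ Set.Ico a (u r a) ↔ m ∈ Set.Ico a (u r a)
  before : ∀ r s a, a < u r a → s < r → ∀ m, u s m ∈ Set.Ioc a (u r a) ↔ m ∈ Set.Ioc a (u r a)
  same : ∀ r a, a < u r a → ∀ m, u r m ∈ Set.Ioo a (u r a) ↔ m ∈ Set.Ioo a (u r a)

theorem list_prod_inv_mem_iff {d : ℕ} {I : Set (Fin d)} {l : List (Equiv.Perm (Fin d))}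
    (h : ∀ σ ∈ l, ∀ m, σ m ∈ I ↔ m ∈ I) (m : Fin d) : l.prod⁻¹ m ∈ I ↔ m ∈ I := by
  induction l generalizing m with
  | nil => simp
  | cons σ l ih =>
    rw [List.prod_cons, mul_inv_rev, Equiv.Perm.mul_apply,
      ih fun τ hτ => h τ (List.mem_cons_of_mem _ hτ), ← h σ List.mem_cons_self,
      perm_apply_inv]

/-- Before the factor with index `r` acts a point is tested against `J`, afterwards against `I`. -/
theorem list_prod_inv_mem_iff_of_mem {d : ℕ} {ι : Type*} [LinearOrder ι]
    {u : ι → Equiv.Perm (Fin d)} {I J : Set (Fin d)} {r : ι}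
    (hI : ∀ s, r < s → ∀ m, u s m ∈ I ↔ m ∈ I) (hJ : ∀ s, s < r → ∀ m, u s m ∈ J ↔ m ∈ J)
    (hr : ∀ m, u r m ∈ J ↔ m ∈ I) {L : List ι} (hL : L.Pairwise (· < ·)) (hrL : r ∈ L)
    (m : Fin d) : (L.map u).prod⁻¹ m ∈ I ↔ m ∈ J := by
  induction L generalizing m with
  | nil => simp at hrL
  | cons s L ih =>
    rw [List.pairwise_cons] at hL
    rw [List.map_cons, List.prod_cons, mul_inv_rev, Equiv.Perm.mul_apply]
    rcases List.mem_cons.1 hrL with rfl | hrL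
    · rw [list_prod_inv_mem_iff (I := I), ← hr, perm_apply_inv]
      intro σ hσ
      obtain ⟨t, ht, rfl⟩ := List.mem_map.1 hσ
      exact hI t (hL.1 t ht)
    · rw [ih hL.2 hrL, ← hJ s (hL.1 r hrL), perm_apply_inv]

/-- The counting half of the characterization: every ascent `(a, r)` of the family, and the largest
element of every orbit of `y`, gives an orbit of `(∏ u s)⁻¹ * y`, and these orbits are
different. The orbit of an ascent stays in `[a, u r a)`, which contains none of the other
representatives that come before it. -/
theorem ArcInvariant.sum_refLength_le {d : ℕ} {ι : Type*} [LinearOrder ι]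
    {u : ι → Equiv.Perm (Fin d)} (hu : ArcInvariant u) (hinc : ∀ s, CyclicallyIncreasing (u s))
    {y : Equiv.Perm (Fin d)} (hy : CyclicallyIncreasing y)
    (hle : ∀ s, orbitPartition (u s) ≤ orbitPartition y) {L : List ι}
    (hL : L.Pairwise (· < ·)) :
    (L.map fun s => refLength (u s)).sum + refLength ((L.map u).prod⁻¹ * y) ≤ refLength y := by
  classical
  set K := (L.map u).prod⁻¹ * y with hK
  let I : ι → Fin d → Set (Fin d) := fun r a => {m | m ∈ Set.Ico a (u r a) ∧ orbitPartition y a m}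
  let J : ι → Fin d → Set (Fin d) := fun r a => {m | m ∈ Set.Ioc a (u r a) ∧ orbitPartition y a m}
  have horb : ∀ s a m, orbitPartition y a (u s m) ↔ orbitPartition y a m := fun s a m =>
    ⟨fun h => Setoid.trans' _ h (Setoid.symm' _ (hle s (orbitPartition_apply _ _))),
      fun h => Setoid.trans' _ h (hle s (orbitPartition_apply _ _))⟩
  have hI : ∀ r a, a < u r a → ∀ s, r < s → ∀ m, u s m ∈ I r a ↔ m ∈ I r a :=
    fun r a ha s hs m => and_congr (hu.after r s a ha hs m) (horb s a m)
  have hJ : ∀ r a, a < u r a → ∀ s, s < r → ∀ m, u s m ∈ J r a ↔ m ∈ J r a :=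
    fun r a ha s hs m => and_congr (hu.before r s a ha hs m) (horb s a m)
  have hr : ∀ r a, a < u r a → ∀ m, u r m ∈ J r a ↔ m ∈ I r a := by
    refine fun r a ha m => and_congr ?_ (horb r a m)
    have h1 := hu.same r a ha m
    rw [Set.mem_Ioo, Set.mem_Ioo] at h1
    rw [Set.mem_Ioc, Set.mem_Ico]
    constructor
    · rintro ⟨h2, h3⟩
      rcases h3.lt_or_eq with h3 | h3
      · exact ⟨(h1.1 ⟨h2, h3⟩).1.le, (h1.1 ⟨h2, h3⟩).2⟩
      · rw [(u r).injective h3]; exact ⟨le_rfl, ha⟩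
    · rintro ⟨h2, h3⟩
      rcases h2.lt_or_eq with h2 | h2
      · exact ⟨(h1.2 ⟨h2, h3⟩).1, (h1.2 ⟨h2, h3⟩).2.le⟩
      · rw [← h2]; exact ⟨ha, le_rfl⟩
  have hyI : ∀ r a, a < u r a → ∀ m, m ∈ I r a → y m ∈ J r a := by
    rintro r a ha m ⟨⟨h1, h2⟩, h3⟩
    have hab : orbitPartition y a (u r a) := hle r (orbitPartition_apply _ _)
    have := hy m (u r a) (Setoid.trans' _ (Setoid.symm' _ h3) hab) h2
    exact ⟨⟨h1.trans_lt this.1, this.2⟩, Setoid.trans' _ h3 (orbitPartition_apply y m)⟩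
  -- the sets `I r a` are unions of orbits of `K`
  have hKI : ∀ r ∈ L, ∀ a, a < u r a → ∀ m m', orbitPartition K m m' → m ∈ I r a → m' ∈ I r a := by
    intro r hrL a ha m m' hmm hm
    have hstep : ∀ m, m ∈ I r a → K m ∈ I r a := fun m hm =>
      (list_prod_inv_mem_iff_of_mem (hI r a ha) (hJ r a ha) (hr r a ha) hL hrL (y m)).2
        (hyI r a ha m hm)
    exact mem_of_orbitPartition hstep hmm hm
  have hKy : orbitPartition K ≤ orbitPartition y := by
    refine orbitPartition_le fun m => ?_
    have h1 : ∀ m, orbitPartition y m ((L.map u).prod m) := list_prod_rel fun t ht b => by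
      obtain ⟨s, -, rfl⟩ := List.mem_map.1 ht
      exact hle s (orbitPartition_apply _ _)
    have h2 := h1 ((L.map u).prod⁻¹ (y m))
    rw [perm_apply_inv] at h2
    exact Setoid.trans' _ (orbitPartition_apply y m) (Setoid.symm' _ h2)
  have hmax : ∀ q : Quotient (orbitPartition y), ∃ M, Quotient.mk (orbitPartition y) M = q ∧
      ∀ m, orbitPartition y M m → m ≤ M := by
    intro q
    induction q using Quotient.inductionOn with | _ x
    obtain ⟨M, hM, hmax⟩ :=
      (Set.toFinite {c | orbitPartition y x c}).exists_maximal
        ⟨x, Setoid.refl' (orbitPartition y) x⟩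
    refine ⟨M, Quotient.sound (Setoid.symm' _ hM), fun m hm => ?_⟩
    by_contra h
    exact h (hmax (Setoid.trans' _ hM hm) (not_le.1 h).le)
  choose M hM hMmax using hmax
  -- the point that represents the ascent `(a, L[i])`, moved past the later permutations
  let rep : (i : Fin L.length) → Fin d → Fin d := fun i a =>
    ((L.drop (i + 1)).map u).prod⁻¹ a
  have hdrop : ∀ i j : Fin L.length, i < j → L[j] ∈ L.drop (i + 1) := by
    intro i j hij
    refine List.mem_drop_iff_getElem.2 ⟨j - (i + 1), by omega, ?_⟩
    have : (i : ℕ) + 1 + (j - (i + 1)) = j := by omega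
    simp [this]
  have hdrop' : ∀ i j : Fin L.length, j ≤ i → ∀ s ∈ L.drop (i + 1), L[j] < s := by
    intro i j hij s hs
    obtain ⟨k, hk, rfl⟩ := List.mem_drop_iff_getElem.1 hs
    exact List.pairwise_iff_getElem.1 hL _ _ _ _ (by omega)
  have hrep1 : ∀ i j : Fin L.length, j ≤ i → ∀ a b, b < u L[j] b →
      (rep i a ∈ I L[j] b ↔ a ∈ I L[j] b) := by
    intro i j hij a b hb
    refine list_prod_inv_mem_iff (fun σ hσ => ?_) a
    obtain ⟨s, hs, rfl⟩ := List.mem_map.1 hσ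
    exact hI _ b hb s (hdrop' i j hij s hs)
  have hrep2 : ∀ i j : Fin L.length, i < j → ∀ a b, b < u L[j] b →
      (rep i a ∈ I L[j] b ↔ a ∈ J L[j] b) := fun i j hij a b hb =>
    list_prod_inv_mem_iff_of_mem (hI _ b hb) (hJ _ b hb) (hr _ b hb)
      (hL.sublist (List.drop_sublist _ _)) (hdrop i j hij) a
  have hself : ∀ (i : Fin L.length) a, a < u L[i] a → rep i a ∈ I L[i] a := fun i a ha =>
    (hrep1 i i le_rfl a a ha).2 ⟨⟨le_rfl, ha⟩, Setoid.refl' _ a⟩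
  have hsep : ∀ (i j : Fin L.length) a b, b < u L[j] b → (a < b ∨ a = b ∧ i < j) →
      rep i a ∉ I L[j] b := by
    intro i j a b hb h hmem
    rcases lt_or_ge i j with hij | hij
    · have := ((hrep2 i j hij a b hb).1 hmem).1.1
      rcases h with h | h
      · exact absurd h this.not_gt
      · exact absurd h.1 this.ne'
    · have := ((hrep1 i j hij a b hb).1 hmem).1.1
      rcases h with h | h
      · exact absurd h this.not_gt
      · exact absurd h.2 hij.not_gt
  let F : Quotient (orbitPartition y) ⊕ (Σ i : Fin L.length, {a // a < u L[i] a}) →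
      Quotient (orbitPartition K) :=
    Sum.elim (fun q => Quotient.mk _ (M q)) fun p => Quotient.mk _ (rep p.1 p.2.1)
  have hMI : ∀ q i a, a < u L[i] a → ¬ orbitPartition K (rep i a) (M q) := by
    intro q i a ha h
    obtain ⟨h1, h2⟩ := hKI L[i] (List.getElem_mem _) a ha _ _ h (hself i a ha)
    have := hMmax q (u L[i] a) (Setoid.trans' _ (Setoid.symm' _ h2)
      (hle _ (orbitPartition_apply _ _)))
    exact absurd h1.2 this.not_gt
  have hF : Function.Injective F := by
    rintro (q | ⟨i, a, ha⟩) (q' | ⟨j, b, hb⟩) h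
    · have h1 : orbitPartition y (M q) (M q') := hKy (Quotient.exact h)
      rw [← hM q, ← hM q', Quotient.sound h1]
    · exact absurd (Setoid.symm' _ (Quotient.exact h)) (hMI q j b hb)
    · exact absurd (Quotient.exact h) (hMI q' i a ha)
    · have h1 : orbitPartition K (rep i a) (rep j b) := Quotient.exact h
      have h2 := hKI L[i] (List.getElem_mem _) a ha _ _ h1 (hself i a ha)
      have h3 := hKI L[j] (List.getElem_mem _) b hb _ _ (Setoid.symm' _ h1) (hself j b hb)
      rcases lt_trichotomy a b with hab | rfl | hab
      · exact absurd h3 (hsep i j a b hb (Or.inl hab))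
      · rcases lt_trichotomy i j with hij | rfl | hij
        · exact absurd h3 (hsep i j a a hb (Or.inr ⟨rfl, hij⟩))
        · rfl
        · exact absurd h2 (hsep j i a a ha (Or.inr ⟨rfl, hij⟩))
      · exact absurd h2 (hsep j i b a ha (Or.inl hab))
  have hcard := Nat.card_le_card_of_injective F hF
  rw [Nat.card_sum, Nat.card_sigma] at hcard
  have hasc : ∀ s, refLength (u s) ≤ Nat.card {a // a < u s a} := fun s => by
    have h1 := (hinc s).le_card_ascents
    have h2 := refLength_add_classCount (u s)
    omega
  have hsum : (L.map fun s => refLength (u s)).sum ≤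
      ∑ i : Fin L.length, Nat.card {a // a < u L[i] a} := by
    rw [← Fin.sum_univ_fun_getElem]
    exact Finset.sum_le_sum fun i _ => hasc _
  have h1 := refLength_add_classCount K
  have h2 := refLength_add_classCount y
  unfold classCount at h1 h2
  omega

/-! ### Reduced factorizations of the rotation and noncrossing families -/

theorem finRotate_val_of_lt {d : ℕ} {a b : Fin d} (h : a < b) :
    (finRotate d a : ℕ) = a + 1 := by
  cases d with
  | zero => exact a.elim0
  | succ n => exact coe_finRotate_of_ne_last (Fin.ne_last_of_lt h)

theorem orbitPartition_finRotate {d : ℕ} (a b : Fin d) : orbitPartition (finRotate d) a b := by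
  have key : ∀ (n : ℕ) (hn : n < d), orbitPartition (finRotate d) ⟨0, by omega⟩ ⟨n, hn⟩ := by
    intro n
    induction n with
    | zero => exact fun _ => Setoid.refl' _ _
    | succ n ih =>
      intro hn
      have h1 := orbitPartition_apply (finRotate d) ⟨n, by omega⟩
      have h2 : finRotate d ⟨n, by omega⟩ = ⟨n + 1, hn⟩ := Fin.ext <|
        finRotate_val_of_lt (a := ⟨n, by omega⟩) (b := ⟨n + 1, hn⟩) (Fin.mk_lt_mk.2 n.lt_succ_self)
      exact Setoid.trans' _ (ih (by omega)) (h2 ▸ h1)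
  exact Setoid.trans' _ (Setoid.symm' _ (key a a.2)) (key b b.2)

theorem cyclicallyIncreasing_finRotate (d : ℕ) : CyclicallyIncreasing (finRotate d) := by
  intro a b _ hab
  have := finRotate_val_of_lt hab
  rw [Fin.lt_def, Fin.le_def]
  rw [Fin.lt_def] at hab
  omega

/-- Every partition of `Fin d` consists of the orbits of a cyclically increasing permutation. -/
theorem exists_cyclicallyIncreasing {d : ℕ} (p : Setoid (Fin d)) :
    ∃ σ : Equiv.Perm (Fin d), CyclicallyIncreasing σ ∧ orbitPartition σ = p := by
  classical
  have hex : ∀ a, ∃ b, p a b ∧ ((a < b ∧ ∀ e, p a e → a < e → b ≤ e) ∨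
      ((∀ e, p a e → e ≤ a) ∧ ∀ e, p a e → b ≤ e)) := by
    intro a
    by_cases h : ∃ e, p a e ∧ a < e
    · obtain ⟨b, hb, hmin⟩ := Set.exists_min_image {e | p a e ∧ a < e} id (Set.toFinite _) h
      exact ⟨b, hb.1, Or.inl ⟨hb.2, fun e he hae => hmin e ⟨he, hae⟩⟩⟩
    · obtain ⟨b, hb, hmin⟩ := Set.exists_min_image {e | p a e} id (Set.toFinite _) ⟨a, p.refl' a⟩
      exact ⟨b, hb, Or.inr ⟨fun e he => not_lt.1 fun hae => h ⟨e, he, hae⟩, hmin⟩⟩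
  choose f hf hf' using hex
  have hlt : ∀ a c, a < c → f a = f c → False := by
    intro a c hac h
    have hpac : p a c := p.trans' (hf a) (h ▸ p.symm' (hf c))
    have h1 : a < f a ∧ f a ≤ c := by
      rcases hf' a with h1 | h1
      · exact ⟨h1.1, h1.2 c hpac hac⟩
      · exact absurd (h1.1 c hpac) hac.not_ge
    rcases hf' c with h2 | h2
    · exact absurd (h ▸ h1.2) h2.1.not_ge
    · exact absurd (h2.2 a (p.symm' hpac)) (h ▸ h1.1).not_ge
  have hinj : Function.Injective f := fun a c h => by
    rcases lt_trichotomy a c with h1 | h1 | h1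
    · exact (hlt a c h1 h).elim
    · exact h1
    · exact (hlt c a h1 h.symm).elim
  let σ : Equiv.Perm (Fin d) := Equiv.ofBijective f (Finite.injective_iff_bijective.1 hinj)
  have hσ : orbitPartition σ ≤ p := orbitPartition_le hf
  have hup : ∀ (n : ℕ) a b, p a b → a ≤ b → (b : ℕ) - a = n → orbitPartition σ a b := by
    intro n
    induction n using Nat.strong_induction_on with
    | _ n ih =>
      intro a b hab hle hn
      rcases hle.lt_or_eq with hlt | rfl
      · rcases hf' a with h1 | h1
        · have h2 := h1.2 b hab hlt
          have h3 := h1.1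
          refine Setoid.trans' _ (orbitPartition_apply σ a)
            (ih (b - f a) ?_ _ b (p.trans' (p.symm' (hf a)) hab) h2 rfl)
          rw [Fin.lt_def] at h3
          rw [Fin.le_def] at h2
          omega
        · exact absurd (h1.1 b hab) hlt.not_ge
      · exact Setoid.refl' _ _
  refine ⟨σ, ?_, le_antisymm hσ fun a b hab => ?_⟩
  · intro a b hab hlt
    rcases hf' a with h1 | h1
    · exact ⟨h1.1, h1.2 b (hσ hab) hlt⟩
    · exact absurd (h1.1 b (hσ hab)) hlt.not_ge
  · rcases le_total a b with h | h
    · exact hup _ a b hab h rfl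
    · exact Setoid.symm' _ (hup _ b a (p.symm' hab) h rfl)

/-- A subword of a factorization can be moved to the front, at the cost of conjugating the other
factors. -/
theorem exists_prod_mul_eq_of_sublist {d : ℕ} {l' l : List (Equiv.Perm (Fin d))}
    (h : l'.Sublist l) :
    ∃ z, l'.prod * z = l.prod ∧ (l'.map refLength).sum + refLength z ≤ (l.map refLength).sum := by
  induction h with
  | slnil => exact ⟨1, by simp, by simp [refLength_one]⟩
  | @cons l₁ l₂ x _ ih =>
    obtain ⟨z, hz, hle⟩ := ih
    refine ⟨l₁.prod⁻¹ * x * l₁.prod⁻¹⁻¹ * z, ?_, ?_⟩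
    · rw [List.prod_cons, ← hz]; group
    · have h1 := refLength_mul_le (l₁.prod⁻¹ * x * l₁.prod⁻¹⁻¹) z
      rw [refLength_conj] at h1
      rw [List.map_cons, List.sum_cons]
      omega
  | @cons_cons l₁ l₂ x _ ih =>
    obtain ⟨z, hz, hle⟩ := ih
    refine ⟨z, by rw [List.prod_cons, List.prod_cons, ← hz, mul_assoc], ?_⟩
    rw [List.map_cons, List.sum_cons, List.map_cons, List.sum_cons]
    omega

theorem refLength_swap_mul_lt {d : ℕ} {σ : Equiv.Perm (Fin d)} {a : Fin d} (h : σ a ≠ a) :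
    refLength (Equiv.swap a (σ a) * σ) < refLength σ := by
  have h1 := classCount_swap_mul h
  have h2 := refLength_add_classCount σ
  have h3 := refLength_add_classCount (Equiv.swap a (σ a) * σ)
  omega

/-- In a reduced factorization `g = x y z`, splitting off the transposition `(a x(a))` from `x` on
the left leaves a reduced factorization of `(a x(a)) g`. -/
theorem orbitPartition_le_swap_mul {d : ℕ} {g x y z : Equiv.Perm (Fin d)} (h : x * y * z = g)
    (hle : refLength x + refLength y + refLength z ≤ refLength g) {a : Fin d} (ha : x a ≠ a) :
    orbitPartition (Equiv.swap a (x a) * x) ≤ orbitPartition (Equiv.swap a (x a) * g) ∧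
      orbitPartition y ≤ orbitPartition (Equiv.swap a (x a) * g) := by
  set t := Equiv.swap a (x a) with ht
  have h1 : refLength (t * x) < refLength x := refLength_swap_mul_lt ha
  have h2 : refLength g ≤ 1 + refLength (t * g) := by
    have h3 := refLength_mul_le t (t * g)
    rw [← mul_assoc, Equiv.swap_mul_self, one_mul] at h3
    exact h3.trans (Nat.add_le_add_right (refLength_swap_le ha.symm) _)
  have h4 := refLength_mul_le y z
  have e1 : t * g = t * x * (y * z) := by rw [← h]; group
  have e2 : t * g = y * (y⁻¹ * (t * x) * y⁻¹⁻¹ * z) := by rw [← h]; group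
  have h5 := refLength_mul_le (y⁻¹ * (t * x) * y⁻¹⁻¹) z
  rw [refLength_conj] at h5
  constructor
  · rw [e1]
    exact (orbitPartition_le_mul (by rw [← e1]; omega)).1
  · rw [e2]
    exact (orbitPartition_le_mul (by rw [← e2]; omega)).1

/-- The analogue of `orbitPartition_le_swap_mul` for a factor `y` to the left of `x`. -/
theorem orbitPartition_le_mul_swap {d : ℕ} {g x y z : Equiv.Perm (Fin d)} (h : y * x * z = g)
    (hle : refLength y + refLength x + refLength z ≤ refLength g) {a : Fin d} (ha : x a ≠ a) :
    orbitPartition y ≤ orbitPartition (g * Equiv.swap a (x a)) := by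
  set t := Equiv.swap a (x a) with ht
  have htt : t * t = 1 := Equiv.swap_mul_self _ _
  have hinv : t⁻¹ = t := Equiv.swap_inv _ _
  have h1 : refLength (t * x) < refLength x := refLength_swap_mul_lt ha
  have h1' : refLength (x * t) = refLength (t * x) := by
    rw [← refLength_conj (t * x) x]; congr 1; group
  have h2 : refLength g ≤ refLength (g * t) + 1 := by
    have h3 := refLength_mul_le (g * t) t
    rw [mul_assoc, htt, mul_one] at h3
    exact h3.trans (Nat.add_le_add_left (refLength_swap_le ha.symm) _)
  have e : g * t = y * (x * t * (t * z * t⁻¹)) := by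
    rw [hinv, ← h]
    calc y * x * z * t = y * x * 1 * z * t := by group
      _ = y * (x * t * (t * z * t)) := by rw [← htt]; group
  have h5 := refLength_mul_le (x * t) (t * z * t⁻¹)
  rw [refLength_conj] at h5
  rw [e]
  exact (orbitPartition_le_mul (by rw [← e]; omega)).1

theorem apply_mem_iff_of_orbitPartition_le {d : ℕ} {σ τ : Equiv.Perm (Fin d)}
    (h : orbitPartition τ ≤ orbitPartition σ) {I : Set (Fin d)} (hI : ∀ m ∈ I, σ m ∈ I)
    (m : Fin d) : τ m ∈ I ↔ m ∈ I :=
  ⟨mem_of_orbitPartition hI (Setoid.symm' _ (h (orbitPartition_apply τ m))),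
    mem_of_orbitPartition hI (h (orbitPartition_apply τ m))⟩

theorem swap_mul_finRotate_mem_Ico {d : ℕ} {a b m : Fin d} (hm : m ∈ Set.Ico a b) :
    (Equiv.swap b a * finRotate d) m ∈ Set.Ico a b := by
  have h1 := finRotate_val_of_lt hm.2
  obtain ⟨h2, h3⟩ := hm
  rw [Equiv.Perm.mul_apply]
  by_cases hb : finRotate d m = b
  · rw [hb, Equiv.swap_apply_left]
    exact ⟨le_rfl, h2.trans_lt h3⟩
  · rw [Fin.le_def] at h2
    rw [Fin.lt_def] at h3
    have hb' : (finRotate d m : ℕ) ≠ b := fun h => hb (Fin.ext h)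
    rw [Equiv.swap_apply_of_ne_of_ne hb (fun h => by rw [h] at h1; omega)]
    rw [Set.mem_Ico, Fin.le_def, Fin.lt_def]
    omega

theorem finRotate_mul_swap_mem_Ioc {d : ℕ} {a b m : Fin d} (hm : m ∈ Set.Ioc a b) :
    (finRotate d * Equiv.swap a b) m ∈ Set.Ioc a b := by
  obtain ⟨h2, h3⟩ := hm
  have hab := h2.trans_le h3
  rw [Equiv.Perm.mul_apply, Set.mem_Ioc]
  by_cases hb : m = b
  · have h1 := finRotate_val_of_lt hab
    rw [hb, Equiv.swap_apply_right, Fin.lt_def, Fin.le_def]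
    rw [Fin.lt_def] at hab
    omega
  · have h3' := lt_of_le_of_ne h3 hb
    have h1 := finRotate_val_of_lt h3'
    rw [Equiv.swap_apply_of_ne_of_ne h2.ne' hb, Fin.lt_def, Fin.le_def]
    rw [Fin.lt_def] at h2 h3'
    omega

theorem pair_sublist_of_pairwise_lt {ι : Type*} [LinearOrder ι] {L : List ι}
    (hL : L.Pairwise (· < ·)) {r s : ι} (hr : r ∈ L) (hs : s ∈ L) (hrs : r < s) :
    [r, s].Sublist L := by
  induction L with
  | nil => simp at hr
  | cons x L ih =>
    rw [List.pairwise_cons] at hL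
    have hsL : s ∈ L := by
      rcases List.mem_cons.1 hs with rfl | h
      · rcases List.mem_cons.1 hr with rfl | h'
        · exact absurd hrs (lt_irrefl _)
        · exact absurd hrs (hL.1 r h').not_gt
      · exact h
    rcases List.mem_cons.1 hr with rfl | h
    · exact (List.singleton_sublist.2 hsL).cons_cons _
    · exact (ih hL.2 h hsL).cons _

/-- The factors of a reduced factorization of `finRotate d` form an arc invariant family of
cyclically increasing permutations: removing the transposition `(a x(a))` of a factor `x` leaves
permutations whose orbits do not leave the intervals cut out by `a` and `x a`. -/
theorem arcInvariant_of_reduced {d : ℕ} {ι : Type*} [LinearOrder ι] {u : ι → Equiv.Perm (Fin d)}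
    {L : List ι} (hL : L.Pairwise (· < ·)) (hsupp : ∀ s, s ∉ L → u s = 1)
    {K : Equiv.Perm (Fin d)} (hK : (L.map u).prod * K = finRotate d)
    (hle : ((L.map u).map refLength).sum + refLength K ≤ refLength (finRotate d)) :
    ArcInvariant u ∧ ∀ s, CyclicallyIncreasing (u s) := by
  have hmem : ∀ r a, u r a ≠ a → r ∈ L := fun r a h => by
    by_contra hr
    simp [hsupp r hr] at h
  have hpair : ∀ r s, r ∈ L → s ∈ L → r < s → ∃ z, u r * u s * z = finRotate d ∧
      refLength (u r) + refLength (u s) + refLength z ≤ refLength (finRotate d) := by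
    intro r s hr hs hrs
    obtain ⟨z, hz, hz'⟩ :=
      exists_prod_mul_eq_of_sublist ((pair_sublist_of_pairwise_lt hL hr hs hrs).map u)
    have h1 := refLength_mul_le z K
    refine ⟨z * K, by rw [← hK, ← hz]; simp [mul_assoc], ?_⟩
    simp only [List.map_cons, List.map_nil, List.sum_cons, List.sum_nil] at hz'
    omega
  have hsingle : ∀ r a, u r a ≠ a → orbitPartition (Equiv.swap a (u r a) * u r) ≤
      orbitPartition (Equiv.swap a (u r a) * finRotate d) := by
    intro r a h
    obtain ⟨z, hz, hz'⟩ :=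
      exists_prod_mul_eq_of_sublist ((List.singleton_sublist.2 (hmem r a h)).map u)
    have h1 := refLength_mul_le z K
    refine (orbitPartition_le_swap_mul (y := 1) (z := z * K) (by rw [← hK, ← hz]; simp [mul_assoc])
      ?_ h).1
    simp only [List.map_cons, List.map_nil, List.sum_cons, List.sum_nil] at hz'
    rw [refLength_one]
    omega
  have hsame : ∀ r a, a < u r a → ∀ m, u r m ∈ Set.Ioo a (u r a) ↔ m ∈ Set.Ioo a (u r a) := by
    intro r a ha m
    have h1 := apply_mem_iff_of_orbitPartition_le (hsingle r a ha.ne') (I := Set.Ico a (u r a))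
      (fun m hm => Equiv.swap_comm a (u r a) ▸ swap_mul_finRotate_mem_Ico hm) m
    rw [Equiv.Perm.mul_apply] at h1
    by_cases hma : m = a
    · simp [hma]
    have hne : u r m ≠ u r a := (u r).injective.ne hma
    constructor
    · rintro ⟨h2, h3⟩
      rw [Equiv.swap_apply_of_ne_of_ne h2.ne' hne] at h1
      have := h1.1 ⟨h2.le, h3⟩
      exact ⟨lt_of_le_of_ne this.1 (Ne.symm hma), this.2⟩
    · rintro ⟨h2, h3⟩
      have h4 := h1.2 ⟨h2.le, h3⟩
      by_cases h5 : u r m = a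
      · rw [h5, Equiv.swap_apply_left] at h4
        exact absurd h4.2 (lt_irrefl _)
      · rw [Equiv.swap_apply_of_ne_of_ne h5 hne] at h4
        exact ⟨lt_of_le_of_ne h4.1 (Ne.symm h5), h4.2⟩
  refine ⟨⟨?_, ?_, hsame⟩, ?_⟩
  · intro r s a ha hrs m
    by_cases hs : s ∈ L
    · obtain ⟨z, hz, hz'⟩ := hpair r s (hmem r a ha.ne') hs hrs
      exact apply_mem_iff_of_orbitPartition_le (orbitPartition_le_swap_mul hz hz' ha.ne').2
        (fun m hm => Equiv.swap_comm a (u r a) ▸ swap_mul_finRotate_mem_Ico hm) m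
    · simp [hsupp s hs]
  · intro r s a ha hrs m
    by_cases hs : s ∈ L
    · obtain ⟨z, hz, hz'⟩ := hpair s r hs (hmem r a ha.ne') hrs
      exact apply_mem_iff_of_orbitPartition_le (orbitPartition_le_mul_swap hz hz' ha.ne')
        (fun m hm => finRotate_mul_swap_mem_Ioc hm) m
    · simp [hsupp s hs]
  · intro r a e hae hlt
    have hne : u r a ≠ a := fun h =>
      hlt.ne (Equiv.Perm.SameCycle.eq_of_left (show Equiv.Perm.SameCycle (u r) a e from hae) h)
    rcases lt_or_gt_of_ne hne with h | h
    · exfalso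
      have h1 := apply_mem_iff_of_orbitPartition_le (hsingle r a hne) (I := Set.Ico (u r a) a)
        (fun m hm => swap_mul_finRotate_mem_Ico hm)
      have h2 : ∀ m ∈ {m | m < u r a ∨ a < m}, u r m ∈ {m | m < u r a ∨ a < m} := by
        intro m hm
        have hma : m ≠ a := by
          rintro rfl
          exact hm.elim (fun h' => absurd h' h.not_gt) (lt_irrefl _)
        have hne' : u r m ≠ u r a := (u r).injective.ne hma
        have h3 := h1 m
        rw [Equiv.Perm.mul_apply] at h3
        have h4 : m ∉ Set.Ico (u r a) a := fun h' =>
          hm.elim (fun h'' => absurd h'' h'.1.not_gt) (fun h'' => absurd h'' h'.2.not_gt)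
        by_cases h5 : u r m = a
        · rw [h5, Equiv.swap_apply_left] at h3
          exact absurd (h3.1 ⟨le_rfl, h⟩) h4
        · rw [Equiv.swap_apply_of_ne_of_ne h5 hne'] at h3
          by_contra h6
          have h6' := not_or.1 h6
          exact h4 (h3.1 ⟨not_lt.1 h6'.1, lt_of_le_of_ne (not_lt.1 h6'.2) h5⟩)
      have := mem_of_orbitPartition h2 (Setoid.symm' _ hae) (Or.inr hlt)
      exact this.elim (fun h' => absurd h' h.not_gt) (lt_irrefl _)
    · refine ⟨h, not_lt.1 fun he => ?_⟩
      have := mem_of_orbitPartition (I := Set.Ioo a (u r a)) (fun m hm => (hsame r a h m).2 hm)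
        (Setoid.symm' _ hae) ⟨hlt, he⟩
      exact lt_irrefl _ this.1

/-- For a member of an arc invariant family, refinement of orbits gives the prefix order. -/
theorem refLength_add_refLength_inv_mul_le {d : ℕ} {ι : Type*} [LinearOrder ι]
    {u : ι → Equiv.Perm (Fin d)} (hu : ArcInvariant u) {s : ι} (hinc : CyclicallyIncreasing (u s))
    {y : Equiv.Perm (Fin d)} (hy : CyclicallyIncreasing y)
    (hle : orbitPartition (u s) ≤ orbitPartition y) :
    refLength (u s) + refLength ((u s)⁻¹ * y) ≤ refLength y := by
  have hu' : ArcInvariant fun _ : Unit => u s :=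
    ⟨fun r t _ _ h => absurd h (by simp), fun r t _ _ h => absurd h (by simp),
      fun _ a ha m => hu.same s a ha m⟩
  simpa using hu'.sum_refLength_le (fun _ => hinc) hy (fun _ => hle) (L := [()]) (by simp)

/-- A family of partitions of `Fin d`, indexed by a linear order, is noncrossing if no two blocks of
its members cross, where the points `(m, s)` are ordered lexicographically. -/
def NoncrossingFamily {d : ℕ} {ι : Type*} [LinearOrder ι] (p : ι → Setoid (Fin d)) : Prop :=
  ∀ s r m₁ m₂ n₁ n₂, p s m₁ m₂ → p r n₁ n₂ → toLex (m₁, s) < toLex (n₁, r) →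
    toLex (n₁, r) < toLex (m₂, s) → toLex (m₂, s) < toLex (n₂, r) → s = r ∧ p s m₁ n₁

theorem ArcInvariant.mem_iff_mem {d : ℕ} {ι : Type*} [LinearOrder ι] {u : ι → Equiv.Perm (Fin d)}
    (hu : ArcInvariant u) {r : ι} {a : Fin d} (ha : a < u r a) (s : ι) (m : Fin d) :
    toLex (u s m, s) ∈ Set.Ioo (toLex (a, r)) (toLex (u r a, r)) ↔
      toLex (m, s) ∈ Set.Ioo (toLex (a, r)) (toLex (u r a, r)) := by
  simp only [Set.mem_Ioo, Prod.Lex.toLex_lt_toLex]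
  rcases lt_trichotomy r s with h | rfl | h
  · have := hu.after r s a ha h m
    simpa [h, h.not_gt, le_iff_lt_or_eq] using this
  · simpa using hu.same r a ha m
  · have := hu.before r s a ha h m
    simpa [h, h.not_gt, le_iff_lt_or_eq] using this

theorem ArcInvariant.noncrossingFamily {d : ℕ} {ι : Type*} [LinearOrder ι]
    {u : ι → Equiv.Perm (Fin d)} (hu : ArcInvariant u) (hinc : ∀ s, CyclicallyIncreasing (u s)) :
    NoncrossingFamily fun s => orbitPartition (u s) := by
  intro s r m₁ m₂ n₁ n₂ hm hn h1 h2 h3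
  -- the last point of the first block before `(n₁, r)`
  obtain ⟨a, ⟨ham, han⟩, hmax⟩ := Set.exists_max_image
    {a | orbitPartition (u s) m₁ a ∧ toLex (a, s) < toLex (n₁, r)} id (Set.toFinite _)
    ⟨m₁, Setoid.refl' _ _, h1⟩
  have ham2 : a < m₂ := by
    have := han.trans h2
    simpa [Prod.Lex.toLex_lt_toLex] using this
  obtain ⟨hb, hb2⟩ := hinc s a m₂ (Setoid.trans' _ (Setoid.symm' _ ham) hm) ham2
  have hmb : orbitPartition (u s) m₁ (u s a) := Setoid.trans' _ ham (orbitPartition_apply _ _)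
  have hnb : toLex (n₁, r) ≤ toLex (u s a, s) :=
    not_lt.1 fun h => (hmax _ ⟨hmb, h⟩).not_gt hb
  rcases hnb.lt_or_eq with hnb | hnb
  · exfalso
    have hmem : ∀ k ∈ {k | toLex (k, r) ∈ Set.Ioo (toLex (a, s)) (toLex (u s a, s))},
        u r k ∈ {k | toLex (k, r) ∈ Set.Ioo (toLex (a, s)) (toLex (u s a, s))} :=
      fun k hk => (hu.mem_iff_mem hb r k).2 hk
    have := (mem_of_orbitPartition hmem hn ⟨han, hnb⟩).2
    have h4 : toLex (u s a, s) ≤ toLex (m₂, s) := by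
      rw [Prod.Lex.toLex_le_toLex]
      exact hb2.lt_or_eq.imp id fun h => ⟨h, le_rfl⟩
    exact absurd (h4.trans_lt h3) this.not_gt
  · obtain ⟨h4, h5⟩ := Prod.mk.inj (toLex.injective hnb)
    exact ⟨h5.symm, h4 ▸ hmb⟩

theorem NoncrossingFamily.arcInvariant {d : ℕ} {ι : Type*} [LinearOrder ι]
    {u : ι → Equiv.Perm (Fin d)} (hu : NoncrossingFamily fun s => orbitPartition (u s))
    (hinc : ∀ s, CyclicallyIncreasing (u s)) : ArcInvariant u := by
  have key : ∀ r s a, a < u r a → ∀ m,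
      toLex (m, s) ∈ Set.Ioo (toLex (a, r)) (toLex (u r a, r)) →
      ∀ k, orbitPartition (u s) m k →
        toLex (k, s) ∈ Set.Ioo (toLex (a, r)) (toLex (u r a, r)) := by
    rintro r s a ha m ⟨h1, h2⟩ k hk
    have hab := orbitPartition_apply (u r) a
    have hno : r = s → ¬ orbitPartition (u r) a m := by
      rintro rfl h
      have h1' : a < m := by simpa [Prod.Lex.toLex_lt_toLex] using h1
      have h2' : m < u r a := by simpa [Prod.Lex.toLex_lt_toLex] using h2
      exact absurd (hinc r a m h h1').2 h2'.not_ge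
    have hne : ∀ c, orbitPartition (u r) a c → toLex (k, s) ≠ toLex (c, r) := by
      intro c hc h
      obtain ⟨rfl, rfl⟩ := Prod.mk.inj (toLex.injective h)
      exact hno rfl (Setoid.trans' _ hc (Setoid.symm' _ hk))
    constructor
    · by_contra h
      have h3 := lt_of_le_of_ne (not_lt.1 h) (hne a (Setoid.refl' _ _))
      obtain ⟨rfl, h4⟩ := hu s r k m a (u r a) (Setoid.symm' _ hk) hab h3 h1 h2
      exact hno rfl (Setoid.symm' _ (Setoid.trans' _ hk h4))
    · by_contra h
      have h3 := lt_of_le_of_ne (not_lt.1 h) (hne _ hab).symm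
      obtain ⟨rfl, h4⟩ := hu r s a (u r a) m k hab hk h1 h2 h3
      exact hno rfl h4
  have key' : ∀ r s a, a < u r a → ∀ m,
      (toLex (u s m, s) ∈ Set.Ioo (toLex (a, r)) (toLex (u r a, r)) ↔
      toLex (m, s) ∈ Set.Ioo (toLex (a, r)) (toLex (u r a, r))) := fun r s a ha m =>
    ⟨fun h => key r s a ha _ h _ (Setoid.symm' _ (orbitPartition_apply _ _)),
      fun h => key r s a ha _ h _ (orbitPartition_apply _ _)⟩
  simp only [Set.mem_Ioo, Prod.Lex.toLex_lt_toLex] at key'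
  refine ⟨fun r s a ha h m => ?_, fun r s a ha h m => ?_, fun r a ha m => ?_⟩
  · simpa [h, h.not_gt, le_iff_lt_or_eq] using key' r s a ha m
  · simpa [h, h.not_gt, le_iff_lt_or_eq] using key' r s a ha m
  · simpa using key' r r a ha m

/-! ### Convex hulls of sets of points of the circle -/

theorem circleParam_injective : Function.Injective circleParam := fun z w h => by
  rw [← exp_circleParam z, ← exp_circleParam w, h]

theorem circleParam_exp {t : ℝ} (h0 : 0 ≤ t) (h1 : t < 1) :
    circleParam (Circle.exp (2 * Real.pi * t)) = t := by
  have hpi := Real.pi_pos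
  have h := exp_circleParam (Circle.exp (2 * Real.pi * t))
  obtain ⟨m, hm⟩ := Circle.exp_eq_exp.1 h
  have h2 : circleParam (Circle.exp (2 * Real.pi * t)) = t + m := by
    have : 2 * Real.pi * circleParam (Circle.exp (2 * Real.pi * t)) = 2 * Real.pi * (t + m) := by
      rw [hm]; ring
    exact mul_left_cancel₀ (by positivity) this
  have h3 := circleParam_mem (Circle.exp (2 * Real.pi * t))
  rw [h2] at h3 ⊢
  have h4 : (-1 : ℝ) < m := by linarith [h3.1]
  have h5 : (m : ℝ) < 1 := by linarith [h3.2]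
  have h6 : m = 0 := by
    have : (-1 : ℤ) < m := by exact_mod_cast h4
    have : m < (1 : ℤ) := by exact_mod_cast h5
    omega
  simp [h6]

theorem circle_re (z : Circle) : (z : ℂ).re = Real.cos (2 * Real.pi * circleParam z) := by
  conv_lhs => rw [← exp_circleParam z, Circle.coe_exp]
  exact Complex.exp_ofReal_mul_I_re _

theorem circle_im (z : Circle) : (z : ℂ).im = Real.sin (2 * Real.pi * circleParam z) := by
  conv_lhs => rw [← exp_circleParam z, Circle.coe_exp]
  exact Complex.exp_ofReal_mul_I_im _

/-- Twice the signed area of the triangle with vertices `z`, `w`, `v`. -/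
noncomputable def triangleDet (z w v : ℂ) : ℝ :=
  (w.re - z.re) * (v.im - z.im) - (v.re - z.re) * (w.im - z.im)

theorem triangleDet_pos {z w v : Circle} (h1 : circleParam z < circleParam w)
    (h2 : circleParam w < circleParam v) : 0 < triangleDet z w v := by
  have hpi := Real.pi_pos
  have hz := (circleParam_mem z).1
  have hv := (circleParam_mem v).2
  set a := Real.pi * (circleParam w - circleParam z) with ha
  set b := Real.pi * (circleParam v - circleParam w) with hb
  set c := 2 * Real.pi * circleParam z with hc
  have hw' : 2 * Real.pi * circleParam w = c + 2 * a := by rw [ha, hc]; ring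
  have hv' : 2 * Real.pi * circleParam v = c + (2 * a + 2 * b) := by rw [ha, hb, hc]; ring
  have key : triangleDet z w v = 4 * Real.sin a * Real.sin b * Real.sin (a + b) := by
    unfold triangleDet
    rw [circle_re, circle_re, circle_re, circle_im, circle_im, circle_im, hw', hv', ← hc,
      Real.cos_add c, Real.cos_add c, Real.sin_add c, Real.sin_add c, Real.sin_add (2 * a),
      Real.cos_add (2 * a), Real.sin_add a b, Real.sin_two_mul, Real.sin_two_mul,
      Real.cos_two_mul', Real.cos_two_mul']
    have e1 := Real.sin_sq_add_cos_sq a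
    have e2 := Real.sin_sq_add_cos_sq b
    have e3 := Real.sin_sq_add_cos_sq c
    generalize Real.sin a = x at *
    generalize Real.cos a = x' at *
    generalize Real.sin b = y at *
    generalize Real.cos b = y' at *
    generalize Real.sin c = s at *
    generalize Real.cos c = t at *
    have f1 : x' ^ 2 = 1 - x ^ 2 := by linarith
    have f2 : y' ^ 2 = 1 - y ^ 2 := by linarith
    have f3 : t ^ 2 = 1 - s ^ 2 := by linarith
    grind
  rw [key]
  have s1 : 0 < Real.sin a := Real.sin_pos_of_pos_of_lt_pi (by rw [ha]; nlinarith)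
    (by rw [ha]; nlinarith)
  have s2 : 0 < Real.sin b := Real.sin_pos_of_pos_of_lt_pi (by rw [hb]; nlinarith)
    (by rw [hb]; nlinarith)
  have s3 : 0 < Real.sin (a + b) := Real.sin_pos_of_pos_of_lt_pi (by rw [ha, hb]; nlinarith)
    (by rw [ha, hb]; nlinarith)
  positivity

/-- The diagonals of a convex quadrilateral meet; the barycentric coordinates of the intersection
point are areas of triangles. -/
theorem segment_inter_segment_nonempty {z₁ w₁ z₂ w₂ : Circle} (h1 : circleParam z₁ < circleParam w₁)
    (h2 : circleParam w₁ < circleParam z₂) (h3 : circleParam z₂ < circleParam w₂) :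
    (segment ℝ (z₁ : ℂ) z₂ ∩ segment ℝ (w₁ : ℂ) w₂).Nonempty := by
  have p1 := triangleDet_pos h2 h3
  have p2 := triangleDet_pos (h1.trans h2) h3
  have p3 := triangleDet_pos h1 (h2.trans h3)
  have p4 := triangleDet_pos h1 h2
  have hsum : triangleDet z₁ z₂ w₂ + triangleDet z₁ w₁ z₂ =
      triangleDet w₁ z₂ w₂ + triangleDet z₁ w₁ w₂ := by
    unfold triangleDet; ring
  set S := triangleDet w₁ z₂ w₂ + triangleDet z₁ w₁ w₂ with hS
  have hS0 : 0 < S := by positivity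
  refine ⟨(triangleDet w₁ z₂ w₂ / S) • (z₁ : ℂ) + (triangleDet z₁ w₁ w₂ / S) • (z₂ : ℂ),
    ⟨_, _, by positivity, by positivity, by rw [← add_div, ← hS, div_self hS0.ne'], rfl⟩,
    ⟨triangleDet z₁ z₂ w₂ / S, triangleDet z₁ w₁ z₂ / S, by positivity, by positivity,
      by rw [← add_div, hsum, div_self hS0.ne'], ?_⟩⟩
  apply Complex.ext
  · simp only [Complex.add_re, Complex.real_smul, Complex.re_ofReal_mul]
    field_simp
    unfold triangleDet; ring
  · simp only [Complex.add_im, Complex.real_smul, Complex.im_ofReal_mul]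
    field_simp
    unfold triangleDet; ring

/-- The position of a point of the circle relative to the line through `e^{2πiα}` and `e^{2πiβ}`
(the tangent line if `α = β`). -/
theorem cos_sub_eq_sin_mul_sin (z : Circle) (α β : ℝ) :
    Real.cos (Real.pi * (β - α)) - (Real.cos (Real.pi * (α + β)) * (z : ℂ).re +
      Real.sin (Real.pi * (α + β)) * (z : ℂ).im) =
    2 * (Real.sin (Real.pi * (circleParam z - α)) * Real.sin (Real.pi * (circleParam z - β))) := by
  rw [circle_re, circle_im, ← Real.cos_sub,
    show Real.pi * (β - α) = Real.pi * (circleParam z - α) - Real.pi * (circleParam z - β) by ring,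
    show Real.pi * (α + β) - 2 * Real.pi * circleParam z =
      -(Real.pi * (circleParam z - α) + Real.pi * (circleParam z - β)) by ring, Real.cos_neg,
    Real.cos_sub, Real.cos_add]
  ring

theorem sin_pi_mul_pos {t : ℝ} (h0 : 0 < t) (h1 : t < 1) : 0 < Real.sin (Real.pi * t) :=
  Real.sin_pos_of_pos_of_lt_pi (mul_pos Real.pi_pos h0) (by nlinarith [Real.pi_pos])

theorem sin_pi_mul_neg {t : ℝ} (h0 : t < 0) (h1 : -1 < t) : Real.sin (Real.pi * t) < 0 := by
  have := sin_pi_mul_pos (t := -t) (by linarith) (by linarith)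
  rw [mul_neg, Real.sin_neg] at this
  linarith

theorem isLinearMap_re_im (x y : ℝ) : IsLinearMap ℝ fun z : ℂ => x * z.re + y * z.im :=
  ⟨fun z w => by simp only [Complex.add_re, Complex.add_im]; ring,
    fun c z => by
      simp only [Complex.real_smul, Complex.re_ofReal_mul, Complex.im_ofReal_mul, smul_eq_mul]
      ring⟩

/-- The line through `e^{2πiα}` and `e^{2πiβ}` separates `A` from `B` if `B` lies between them. -/
theorem disjoint_convexHull_of_inside {A B : Set Circle} {α β : ℝ} (hα : α ∈ Set.Ico (0 : ℝ) 1)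
    (hβ : β ∈ Set.Ico (0 : ℝ) 1)
    (hA : ∀ z ∈ A, circleParam z ≤ α ∧ circleParam z ≤ β ∨ α ≤ circleParam z ∧ β ≤ circleParam z)
    (hB : ∀ z ∈ B, α < circleParam z ∧ circleParam z < β) :
    Disjoint (convexHull ℝ ((fun z : Circle => (z : ℂ)) '' A))
      (convexHull ℝ ((fun z : Circle => (z : ℂ)) '' B)) := by
  have hl := isLinearMap_re_im (Real.cos (Real.pi * (α + β))) (Real.sin (Real.pi * (α + β)))
  refine Set.disjoint_of_subset
    (convexHull_min ?_ (convex_halfSpace_le hl (Real.cos (Real.pi * (β - α)))))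
    (convexHull_min ?_ (convex_halfSpace_gt hl (Real.cos (Real.pi * (β - α)))))
    (Set.disjoint_left.2 fun z h1 h2 => absurd (Set.mem_ofPred.1 h1) (not_le.2 h2))
  · rintro _ ⟨z, hz, rfl⟩
    have h := cos_sub_eq_sin_mul_sin z α β
    have hm := circleParam_mem z
    have : 0 ≤ Real.sin (Real.pi * (circleParam z - α)) *
        Real.sin (Real.pi * (circleParam z - β)) := by
      rcases hA z hz with ⟨h1, h2⟩ | ⟨h1, h2⟩
      · rcases h1.lt_or_eq with h1 | h1
        · rcases h2.lt_or_eq with h2 | h2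
          · exact (mul_pos_of_neg_of_neg (sin_pi_mul_neg (by linarith) (by linarith [hm.1, hα.2]))
              (sin_pi_mul_neg (by linarith) (by linarith [hm.1, hβ.2]))).le
          · simp [h2]
        · simp [h1]
      · rcases h1.lt_or_eq with h1 | h1
        · rcases h2.lt_or_eq with h2 | h2
          · exact (mul_pos (sin_pi_mul_pos (by linarith) (by linarith [hm.2, hα.1]))
              (sin_pi_mul_pos (by linarith) (by linarith [hm.2, hβ.1]))).le
          · simp [h2]
        · simp [h1]
    rw [Set.mem_ofPred]
    linarith
  · rintro _ ⟨z, hz, rfl⟩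
    have h := cos_sub_eq_sin_mul_sin z α β
    have hm := circleParam_mem z
    obtain ⟨h1, h2⟩ := hB z hz
    have := mul_neg_of_pos_of_neg
      (sin_pi_mul_pos (t := circleParam z - α) (by linarith) (by linarith [hm.2, hα.1]))
      (sin_pi_mul_neg (t := circleParam z - β) (by linarith) (by linarith [hm.1, hβ.2]))
    rw [Set.mem_ofPred]
    linarith

/-- The case in which `B` lies outside `[α, β]`, that is, in the gap of `A` around the point `1`; the
line is the tangent at `e^{2πiα}` if `α = β`. -/
theorem disjoint_convexHull_of_outside {A B : Set Circle} {α β : ℝ} (hα : α ∈ Set.Ico (0 : ℝ) 1)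
    (hβ : β ∈ Set.Ico (0 : ℝ) 1)
    (hA : ∀ z ∈ A, α ≤ circleParam z ∧ circleParam z ≤ β)
    (hB : ∀ z ∈ B, circleParam z < α ∧ circleParam z < β ∨ α < circleParam z ∧ β < circleParam z) :
    Disjoint (convexHull ℝ ((fun z : Circle => (z : ℂ)) '' A))
      (convexHull ℝ ((fun z : Circle => (z : ℂ)) '' B)) := by
  have hl := isLinearMap_re_im (Real.cos (Real.pi * (α + β))) (Real.sin (Real.pi * (α + β)))
  refine Set.disjoint_of_subset
    (convexHull_min ?_ (convex_halfSpace_ge hl (Real.cos (Real.pi * (β - α)))))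
    (convexHull_min ?_ (convex_halfSpace_lt hl (Real.cos (Real.pi * (β - α)))))
    (Set.disjoint_left.2 fun z h1 h2 => absurd (Set.mem_ofPred.1 h1) (not_le.2 h2))
  · rintro _ ⟨z, hz, rfl⟩
    have h := cos_sub_eq_sin_mul_sin z α β
    have hm := circleParam_mem z
    have : Real.sin (Real.pi * (circleParam z - α)) *
        Real.sin (Real.pi * (circleParam z - β)) ≤ 0 := by
      obtain ⟨h1, h2⟩ := hA z hz
      rcases h1.lt_or_eq with h1 | h1
      · rcases h2.lt_or_eq with h2 | h2
        · exact (mul_neg_of_pos_of_neg (sin_pi_mul_pos (by linarith) (by linarith [hm.2, hα.1]))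
            (sin_pi_mul_neg (by linarith) (by linarith [hm.1, hβ.2]))).le
        · simp [h2]
      · simp [h1]
    rw [Set.mem_ofPred]
    linarith
  · rintro _ ⟨z, hz, rfl⟩
    have h := cos_sub_eq_sin_mul_sin z α β
    have hm := circleParam_mem z
    have : 0 < Real.sin (Real.pi * (circleParam z - α)) *
        Real.sin (Real.pi * (circleParam z - β)) := by
      rcases hB z hz with ⟨h1, h2⟩ | ⟨h1, h2⟩
      · exact mul_pos_of_neg_of_neg (sin_pi_mul_neg (by linarith) (by linarith [hm.1, hα.2]))
          (sin_pi_mul_neg (by linarith) (by linarith [hm.1, hβ.2]))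
      · exact mul_pos (sin_pi_mul_pos (by linarith) (by linarith [hm.2, hα.1]))
          (sin_pi_mul_pos (by linarith) (by linarith [hm.2, hβ.1]))
    rw [Set.mem_ofPred]
    linarith

/-- Disjointness of convex hulls in terms of the cyclic order of the circle. -/
theorem isNoncrossing_iff {π : Setoid Circle} (hfin : ∀ z, {w | π z w}.Finite) :
    IsNoncrossing π ↔ ∀ z₁ z₂ w₁ w₂, π z₁ z₂ → π w₁ w₂ → circleParam z₁ < circleParam w₁ →
      circleParam w₁ < circleParam z₂ → circleParam z₂ < circleParam w₂ → π z₁ w₁ := by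
  constructor
  · intro h z₁ z₂ w₁ w₂ hz hw h1 h2 h3
    by_contra hne
    have hAB : {x | π x z₁} ≠ {x | π x w₁} := fun he => by
      have : z₁ ∈ {x | π x w₁} := he ▸ π.refl' z₁
      exact hne this
    have hd := h (Setoid.mem_classes π z₁) (Setoid.mem_classes π w₁) hAB
    obtain ⟨x, hx1, hx2⟩ := segment_inter_segment_nonempty h1 h2 h3
    refine Set.disjoint_left.1 hd (segment_subset_convexHull ?_ ?_ hx1)
      (segment_subset_convexHull ?_ ?_ hx2)
    · exact ⟨z₁, π.refl' z₁, rfl⟩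
    · exact ⟨z₂, π.symm' hz, rfl⟩
    · exact ⟨w₁, π.refl' w₁, rfl⟩
    · exact ⟨w₂, π.symm' hw, rfl⟩
  · rintro h A ⟨a, rfl⟩ B ⟨b, rfl⟩ hAB
    have hfin' : {x | π x a}.Finite := (hfin a).subset fun x hx => π.symm' hx
    have hne : ∀ x y, π x a → π y b → ¬ π x y := fun x y hx hy hxy => hAB <| by
      have hab : π a b := π.trans' (π.symm' hx) (π.trans' hxy hy)
      ext z
      exact ⟨fun hz => π.trans' hz hab, fun hz => π.trans' hz (π.symm' hab)⟩
    have hneq : ∀ x y, π x a → π y b → circleParam x ≠ circleParam y := fun x y hx hy hxy =>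
      hne x y hx hy (circleParam_injective hxy ▸ π.refl' x)
    have hrel : ∀ {x y c}, π x c → π y c → π x y := fun hx hy => π.trans' hx (π.symm' hy)
    by_cases hex : ∃ y, π y b ∧ (∃ x, π x a ∧ circleParam x < circleParam y) ∧
        ∃ x, π x a ∧ circleParam y < circleParam x
    · obtain ⟨y, hy, hlow, hhigh⟩ := hex
      obtain ⟨p, ⟨hp, hpy⟩, hpmax⟩ := Set.exists_max_image
        {x | π x a ∧ circleParam x < circleParam y} circleParam
        (hfin'.subset fun x hx => hx.1) hlow
      obtain ⟨q, ⟨hq, hqy⟩, hqmin⟩ := Set.exists_min_image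
        {x | π x a ∧ circleParam y < circleParam x} circleParam
        (hfin'.subset fun x hx => hx.1) hhigh
      refine disjoint_convexHull_of_inside (circleParam_mem p) (circleParam_mem q) ?_ ?_
      · intro x hx
        rcases lt_or_gt_of_ne (hneq x y hx hy) with hxy | hxy
        · have := hpmax x ⟨hx, hxy⟩
          exact Or.inl ⟨this, by linarith⟩
        · have := hqmin x ⟨hx, hxy⟩
          exact Or.inr ⟨by linarith, this⟩
      · intro x hx
        constructor
        · by_contra hlt
          have hlt' := lt_of_le_of_ne (not_lt.1 hlt) (hneq p x hp hx).symm
          exact hne p x hp hx (π.symm' (h x y p q (hrel hx hy) (hrel hp hq) hlt' hpy hqy))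
        · by_contra hlt
          have hlt' := lt_of_le_of_ne (not_lt.1 hlt) (hneq q x hq hx)
          exact hne p y hp hy (h p q y x (hrel hp hq) (hrel hy hx) hpy hqy hlt')
    · obtain ⟨p, hp, hpmin⟩ := Set.exists_min_image {x | π x a} circleParam hfin' ⟨a, π.refl' a⟩
      obtain ⟨q, hq, hqmax⟩ := Set.exists_max_image {x | π x a} circleParam hfin' ⟨a, π.refl' a⟩
      refine disjoint_convexHull_of_outside (circleParam_mem p) (circleParam_mem q)
        (fun x hx => ⟨hpmin x hx, hqmax x hx⟩) fun x hx => ?_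
      have hpq := hpmin q hq
      rcases lt_or_gt_of_ne (hneq p x hp hx) with h1 | h1
      · rcases lt_or_gt_of_ne (hneq q x hq hx) with h2 | h2
        · exact Or.inr ⟨h1, h2⟩
        · exact absurd ⟨x, hx, ⟨p, hp, h1⟩, ⟨q, hq, h2⟩⟩ hex
      · exact Or.inl ⟨h1, by linarith⟩

/-! ### Fibers of the power map -/

/-- The point of the circle with label `m` in the fiber over `e^{2πis}`. -/
noncomputable def fiberPoint (d : ℕ) (m : Fin d) (s : ℝ) : Circle :=
  Circle.exp (2 * Real.pi * ((m + s) / d))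

theorem circleParam_fiberPoint {d : ℕ} [NeZero d] {m : Fin d} {s : ℝ} (h0 : 0 ≤ s) (h1 : s < 1) :
    circleParam (fiberPoint d m s) = (m + s) / d := by
  have hd : (0 : ℝ) < d := by exact_mod_cast Nat.pos_of_ne_zero (NeZero.ne d)
  refine circleParam_exp (by positivity) ?_
  rw [div_lt_one hd]
  have : (m : ℝ) + 1 ≤ d := by exact_mod_cast m.2
  linarith

theorem circleParam_pow (d : ℕ) (z : Circle) :
    circleParam (z ^ d) = Int.fract (d * circleParam z) := by
  rw [← circleParam_exp (Int.fract_nonneg (d * circleParam z)) (Int.fract_lt_one _)]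
  congr 1
  conv_lhs => rw [← exp_circleParam z]
  rw [← Circle.exp_nsmul, Circle.exp_eq_exp]
  refine ⟨⌊d * circleParam z⌋, ?_⟩
  rw [← Int.self_sub_floor, nsmul_eq_mul]
  ring

theorem fiberLabel_add_circleParam_pow {d : ℕ} [NeZero d] (z : Circle) :
    (fiberLabel d z : ℝ) + circleParam (z ^ d) = d * circleParam z := by
  rw [circleParam_pow, fiberLabel]
  have h0 : 0 ≤ d * circleParam z := mul_nonneg (Nat.cast_nonneg _) (circleParam_mem z).1
  have := Int.floor_add_fract (d * circleParam z)
  rw [← natCast_floor_eq_intCast_floor h0] at this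
  exact this

theorem fiberPoint_fiberLabel {d : ℕ} [NeZero d] (z : Circle) :
    fiberPoint d (fiberLabel d z) (circleParam (z ^ d)) = z := by
  have hd : (d : ℝ) ≠ 0 := Nat.cast_ne_zero.2 (NeZero.ne d)
  rw [fiberPoint, fiberLabel_add_circleParam_pow, mul_div_cancel_left₀ _ hd, exp_circleParam]

theorem natCast_add_eq_natCast_add {m n : ℕ} {s t : ℝ} (hs : s ∈ Set.Ico (0 : ℝ) 1)
    (ht : t ∈ Set.Ico (0 : ℝ) 1) (h : (m : ℝ) + s = n + t) : m = n ∧ s = t := by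
  have h1 : (m : ℝ) < n + 1 := by linarith [hs.1, ht.2]
  have h2 : (n : ℝ) < m + 1 := by linarith [hs.2, ht.1]
  have h3 : m < n + 1 := by exact_mod_cast h1
  have h4 : n < m + 1 := by exact_mod_cast h2
  have h5 : m = n := by omega
  exact ⟨h5, by rw [h5] at h; linarith⟩

theorem fiberLabel_fiberPoint {d : ℕ} [NeZero d] {m : Fin d} {s : ℝ} (h0 : 0 ≤ s) (h1 : s < 1) :
    fiberLabel d (fiberPoint d m s) = m ∧ circleParam (fiberPoint d m s ^ d) = s := by
  have hd : (d : ℝ) ≠ 0 := Nat.cast_ne_zero.2 (NeZero.ne d)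
  have h := fiberLabel_add_circleParam_pow (d := d) (fiberPoint d m s)
  rw [circleParam_fiberPoint h0 h1, mul_div_cancel₀ _ hd] at h
  obtain ⟨h2, h3⟩ := natCast_add_eq_natCast_add (circleParam_mem _) ⟨h0, h1⟩ h
  exact ⟨Fin.ext h2, h3⟩

theorem fiberPoint_pow {d : ℕ} [NeZero d] (m : Fin d) (z : Circle) :
    fiberPoint d m (circleParam z) ^ d = z :=
  circleParam_injective
    (fiberLabel_fiberPoint (d := d) (m := m) (circleParam_mem z).1 (circleParam_mem z).2).2

theorem circleParam_lt_iff (d : ℕ) [NeZero d] (z w : Circle) :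
    circleParam z < circleParam w ↔ toLex (fiberLabel d z, circleParamI (z ^ d)) <
      toLex (fiberLabel d w, circleParamI (w ^ d)) := by
  have hd : (0 : ℝ) < d := by exact_mod_cast Nat.pos_of_ne_zero (NeZero.ne d)
  have hz := fiberLabel_add_circleParam_pow (d := d) z
  have hw := fiberLabel_add_circleParam_pow (d := d) w
  have mz := circleParam_mem (z ^ d)
  have mw := circleParam_mem (w ^ d)
  rw [Prod.Lex.toLex_lt_toLex, ← mul_lt_mul_iff_right₀ hd, ← hz, ← hw]
  change _ ↔ _ ∨ fiberLabel d z = fiberLabel d w ∧ circleParam (z ^ d) < circleParam (w ^ d)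
  constructor
  · intro h
    rcases lt_trichotomy (fiberLabel d z) (fiberLabel d w) with h1 | h1 | h1
    · exact Or.inl h1
    · rw [h1] at h
      exact Or.inr ⟨h1, by linarith⟩
    · have : (fiberLabel d w : ℝ) + 1 ≤ fiberLabel d z := by exact_mod_cast h1
      linarith [mz.1, mw.2]
  · rintro (h1 | ⟨h1, h2⟩)
    · have : (fiberLabel d z : ℝ) + 1 ≤ fiberLabel d w := by exact_mod_cast h1
      linarith [mz.2, mw.1]
    · rw [h1]; linarith

theorem DegreePartition.finite_class {d : ℕ} [NeZero d] (π : DegreePartition d) (z : Circle) :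
    {w | π.1 z w}.Finite := by
  refine Set.Finite.of_injOn (f := fiberLabel d) (t := Set.univ) (fun _ _ => Set.mem_univ _) ?_
    Set.finite_univ
  intro x hx y hy hxy
  rw [← fiberPoint_fiberLabel (d := d) x, ← fiberPoint_fiberLabel (d := d) y, hxy,
    ← π.2 z x hx, ← π.2 z y hy]

/-! ### Linear and circular factorization posets -/

theorem refLength_list_prod_le {d : ℕ} (l : List (Equiv.Perm (Fin d))) :
    refLength l.prod ≤ (l.map refLength).sum := by
  induction l with
  | nil => simp [refLength_one]
  | cons σ l ih =>
    rw [List.prod_cons, List.map_cons, List.sum_cons]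
    exact (refLength_mul_le _ _).trans (Nat.add_le_add_left ih _)

theorem prefixLE_iff {d : ℕ} {h g : Equiv.Perm (Fin d)} :
    PrefixLE (transpositions d) h g ↔ refLength h + refLength (h⁻¹ * g) ≤ refLength g := by
  constructor
  · rintro ⟨h', -, -, rfl, hl⟩
    rw [inv_mul_cancel_left]
    exact hl.le
  · intro hl
    refine ⟨h⁻¹ * g, by simp [closure_transpositions], by simp [closure_transpositions], by simp,
      hl.antisymm ?_⟩
    simpa using refLength_mul_le h (h⁻¹ * g)

theorem orbitPartition_le_of_prefixLE {d : ℕ} {h g : Equiv.Perm (Fin d)}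
    (hhg : PrefixLE (transpositions d) h g) : orbitPartition h ≤ orbitPartition g := by
  obtain ⟨h', -, -, rfl, hl⟩ := hhg
  exact (orbitPartition_le_mul hl.le).1

theorem prefixLE_conj {d : ℕ} {h g : Equiv.Perm (Fin d)} (hhg : PrefixLE (transpositions d) h g)
    (c : Equiv.Perm (Fin d)) : PrefixLE (transpositions d) (c * h * c⁻¹) (c * g * c⁻¹) := by
  rw [prefixLE_iff] at *
  rw [show (c * h * c⁻¹)⁻¹ * (c * g * c⁻¹) = c * (h⁻¹ * g) * c⁻¹ by group, refLength_conj,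
    refLength_conj, refLength_conj]
  exact hhg

/-- The points of the interval that carry the entries of the row vector of `u`. -/
noncomputable def GMultiset.points {G : Type*} [Group G] (u : GMultiset unitInterval G) :
    List unitInterval :=
  0 :: (u.innerSupport.sort (· ≤ ·) ++ [1])

theorem GMultiset.entries_factVector {G : Type*} [Group G] (u : GMultiset unitInterval G) :
    u.factVector.entries = u.points.map u.1 := by
  simp [factVector, FactVector.entries, points]

theorem GMultiset.mem_innerSupport {G : Type*} [Group G] (u : GMultiset unitInterval G)
    {r : unitInterval} : r ∈ u.innerSupport ↔ u.1 r ≠ 1 ∧ 0 < r ∧ r < 1 := by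
  simp [innerSupport]

theorem GMultiset.pairwise_points {G : Type*} [Group G] (u : GMultiset unitInterval G) :
    u.points.Pairwise (· < ·) := by
  have hm : ∀ r ∈ u.innerSupport.sort (· ≤ ·), 0 < r ∧ r < 1 := fun r hr =>
    (u.mem_innerSupport.1 ((Finset.mem_sort _).1 hr)).2
  refine List.pairwise_cons.2 ⟨fun r hr => ?_, List.pairwise_append.2
    ⟨u.innerSupport.sortedLT_sort.pairwise, by simp, fun r hr s hs => ?_⟩⟩
  · rcases List.mem_append.1 hr with hr | hr
    · exact (hm r hr).1
    · rw [List.mem_singleton.1 hr]; exact zero_lt_one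
  · rw [List.mem_singleton.1 hs]
    exact (hm r hr).2

theorem GMultiset.eq_one_of_notMem_points {G : Type*} [Group G] (u : GMultiset unitInterval G)
    {r : unitInterval} (hr : r ∉ u.points) : u.1 r = 1 := by
  by_contra h
  simp only [points, List.mem_cons, List.mem_append, Finset.mem_sort, mem_innerSupport,
    List.not_mem_nil, or_false, not_or] at hr
  exact hr.2.1 ⟨h, unitInterval.pos_iff_ne_zero.2 hr.1, unitInterval.lt_one_iff_ne_one.2 hr.2.2⟩

/-- Membership in the linear poset, as a reduced factorization of `g` with one more factor `K`.
Inequality suffices in the length condition because the length is subadditive. -/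
theorem exists_mem_weightedFactorizations_iff {d : ℕ} (g : Equiv.Perm (Fin d))
    (u : GMultiset unitInterval (Equiv.Perm (Fin d))) :
    (∃ h ∈ prefixInterval (transpositions d) g, u ∈ weightedFactorizations (transpositions d) h) ↔
      ∃ K, (u.points.map u.1).prod * K = g ∧
        ((u.points.map u.1).map refLength).sum + refLength K ≤ refLength g := by
  constructor
  · rintro ⟨h, ⟨-, K, -, -, hK, hl⟩, hu⟩
    have h1 := hu.sum_length
    have h2 := hu.prod_eq
    rw [u.entries_factVector] at h1 h2
    refine ⟨K, by rw [h2, hK], ?_⟩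
    change ((u.points.map u.1).map (wordLength _)).sum + wordLength _ K ≤ _
    rw [h1, hl]
  · rintro ⟨K, hK, hl⟩
    have h1 := refLength_list_prod_le (u.points.map u.1)
    have h2 := refLength_mul_le (u.points.map u.1).prod K
    rw [hK] at h2
    refine ⟨(u.points.map u.1).prod, ⟨prefixLE_iff.2 (by simp [refLength_one]),
      prefixLE_iff.2 ?_⟩, ⟨fun y _ => by simp [closure_transpositions], ?_, ?_, ?_⟩⟩
    · rw [show (u.points.map u.1).prod⁻¹ * g = K by rw [← hK]; group]
      omega
    · intro y hy
      obtain ⟨r, hr, rfl⟩ := List.mem_map.1 hy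
      exact (u.mem_innerSupport.1 ((Finset.mem_sort _).1 hr)).1
    · rw [u.entries_factVector]
      change ((u.points.map u.1).map refLength).sum = refLength _
      omega
    · rw [u.entries_factVector]

/-- Conjugating the value at `1` by `g` and moving it to the front keeps a factorization
reduced. -/
theorem LinearFactPoset.exists_circular {d : ℕ} {g : Equiv.Perm (Fin d)}
    (u : LinearFactPoset (transpositions d) g) :
    ∃ K, g * u.val 1 * g⁻¹ * u.val 0 * ((u.1.innerSupport.sort (· ≤ ·)).map u.val).prod * K = g ∧
      refLength (u.val 1) + refLength (u.val 0) +
        (((u.1.innerSupport.sort (· ≤ ·)).map u.val).map refLength).sum + refLength K ≤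
          refLength g := by
  obtain ⟨K, hK, hl⟩ := (exists_mem_weightedFactorizations_iff g u.1).1 u.2
  simp only [GMultiset.points, List.map_cons, List.map_append, List.map_nil, List.prod_cons,
    List.prod_append, List.prod_nil, List.sum_cons, List.sum_append, List.sum_nil] at hK hl
  change u.val 0 * (((u.1.innerSupport.sort (· ≤ ·)).map u.val).prod * (u.val 1 * 1)) * K = g at hK
  change refLength (u.val 0) + ((((u.1.innerSupport.sort (· ≤ ·)).map u.val).map refLength).sum +
    (refLength (u.val 1) + 0)) + refLength K ≤ refLength g at hl
  refine ⟨u.val 1 * K * (u.val 1)⁻¹, ?_, ?_⟩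
  · generalize u.val 0 = a at *
    generalize u.val 1 = b at *
    generalize ((u.1.innerSupport.sort (· ≤ ·)).map u.val).prod = M at *
    have : g⁻¹ = K⁻¹ * b⁻¹ * M⁻¹ * a⁻¹ := by rw [← hK]; group
    rw [this]
    group
  · rw [refLength_conj]
    omega

theorem LinearFactPoset.refLength_circular {d : ℕ} {g : Equiv.Perm (Fin d)}
    (u : LinearFactPoset (transpositions d) g) :
    refLength (g * u.val 1 * g⁻¹) + refLength (u.val 0) ≤
      refLength (g * u.val 1 * g⁻¹ * u.val 0) := by
  obtain ⟨K, hK, hl⟩ := u.exists_circular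
  have h1 := refLength_mul_le (g * u.val 1 * g⁻¹ * u.val 0 *
    ((u.1.innerSupport.sort (· ≤ ·)).map u.val).prod) K
  have h2 := refLength_mul_le (g * u.val 1 * g⁻¹ * u.val 0)
    ((u.1.innerSupport.sort (· ≤ ·)).map u.val).prod
  have h3 := refLength_list_prod_le ((u.1.innerSupport.sort (· ≤ ·)).map u.val)
  rw [hK] at h1
  rw [refLength_conj]
  omega

/-- Every element of the circular poset has a representative that is trivial at `1`. -/
theorem CircularFactPoset.exists_rep {d : ℕ} {g : Equiv.Perm (Fin d)}
    (x : CircularFactPoset (transpositions d) g) :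
    ∃ u : LinearFactPoset (transpositions d) g,
      Quotient.mk (circularSetoid (transpositions d) g) u = x ∧ u.val 1 = 1 := by
  classical
  induction x using Quotient.inductionOn with | _ u
  let f : unitInterval → Equiv.Perm (Fin d) := fun r =>
    if r = 0 then g * u.val 1 * g⁻¹ * u.val 0 else if r = 1 then 1 else u.val r
  have hf : ∀ r, 0 < r → r < 1 → f r = u.val r := fun r h0 h1 => by
    simp [f, h0.ne', h1.ne]
  have hf0 : f 0 = g * u.val 1 * g⁻¹ * u.val 0 := by simp [f]
  have hf1 : f 1 = 1 := by simp [f]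
  have hfin : (Function.mulSupport f).Finite := by
    refine (u.1.2.union (Set.finite_singleton 0)).subset fun r hr => ?_
    by_cases h0 : r = 0
    · exact Or.inr h0
    · refine Or.inl ?_
      by_cases h1 : r = 1
      · simp [h1, hf1] at hr
      · rwa [Function.mem_mulSupport, hf r (unitInterval.pos_iff_ne_zero.2 h0)
          (unitInterval.lt_one_iff_ne_one.2 h1)] at hr
  let v : GMultiset unitInterval (Equiv.Perm (Fin d)) := ⟨f, hfin⟩
  have hv : v.innerSupport = u.1.innerSupport := by
    ext r
    rw [GMultiset.mem_innerSupport, GMultiset.mem_innerSupport]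
    refine and_congr_left fun h => ?_
    change f r ≠ 1 ↔ _
    rw [hf r h.1 h.2]
    rfl
  have hmap : (v.innerSupport.sort (· ≤ ·)).map v.1 =
      (u.1.innerSupport.sort (· ≤ ·)).map u.val := by
    rw [hv]
    refine List.map_congr_left fun r hr => ?_
    have := (u.1.mem_innerSupport.1 ((Finset.mem_sort _).1 hr)).2
    exact hf r this.1 this.2
  have hmem : ∃ h ∈ prefixInterval (transpositions d) g,
      v ∈ weightedFactorizations (transpositions d) h := by
    rw [exists_mem_weightedFactorizations_iff]
    obtain ⟨K, hK, hl⟩ := u.exists_circular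
    have h1 := refLength_mul_le (g * u.val 1 * g⁻¹) (u.val 0)
    rw [refLength_conj] at h1
    refine ⟨K, ?_, ?_⟩
    · simp only [GMultiset.points, List.map_cons, List.map_append, List.map_nil, List.prod_cons,
        List.prod_append, List.prod_nil]
      rw [hmap, show v.1 0 = f 0 from rfl, show v.1 1 = f 1 from rfl, hf0, hf1, mul_one, mul_one]
      exact hK
    · simp only [GMultiset.points, List.map_cons, List.map_append, List.map_nil,
        List.sum_cons, List.sum_append, List.sum_nil]
      rw [hmap, show v.1 0 = f 0 from rfl, show v.1 1 = f 1 from rfl, hf0, hf1, refLength_one]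
      omega
  refine ⟨⟨v, hmem⟩, Quotient.sound ⟨hf, ?_⟩, hf1⟩
  change g * f 1 * g⁻¹ * f 0 = _
  rw [hf1, hf0]
  group

theorem LinearFactPoset.arcInvariant {d : ℕ} (u : LinearFactPoset (transpositions d) (finRotate d)) :
    ArcInvariant u.val ∧ ∀ s, CyclicallyIncreasing (u.val s) := by
  obtain ⟨K, hK, hl⟩ := (exists_mem_weightedFactorizations_iff _ u.1).1 u.2
  exact arcInvariant_of_reduced u.1.pairwise_points (fun s => u.1.eq_one_of_notMem_points) hK hl

/-- The converse of `LinearFactPoset.arcInvariant`. -/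
theorem exists_linearFactPoset {d : ℕ} {u : unitInterval → Equiv.Perm (Fin d)}
    (hu : ArcInvariant u) (hinc : ∀ s, CyclicallyIncreasing (u s)) :
    ∃ v : LinearFactPoset (transpositions d) (finRotate d), v.val = u := by
  have hle : ∀ s, orbitPartition (u s) ≤ orbitPartition (finRotate d) :=
    fun s a b _ => orbitPartition_finRotate a b
  have hsum := fun L hL =>
    hu.sum_refLength_le hinc (cyclicallyIncreasing_finRotate d) hle (L := L) hL
  -- every nontrivial value contributes at least `1` to a sum bounded by the length of the rotation
  have hfin : (Function.mulSupport u).Finite := by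
    by_contra hinf
    obtain ⟨T, hT, hcard⟩ := Set.Infinite.exists_subset_card_eq hinf (d + 1)
    have h1 := hsum _ T.sortedLT_sort.pairwise
    have h2 : ((T.sort (· ≤ ·)).map fun s => refLength (u s)).length • 1 ≤
        ((T.sort (· ≤ ·)).map fun s => refLength (u s)).sum := by
      refine List.card_nsmul_le_sum _ 1 fun n hn => ?_
      obtain ⟨s, hs, rfl⟩ := List.mem_map.1 hn
      refine Nat.one_le_iff_ne_zero.2 fun h => hT ((Finset.mem_sort _).1 hs) ?_
      obtain ⟨l, -, hl, hlen⟩ := exists_reduced_word (u s)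
      rw [h] at hlen
      rw [← hl, List.eq_nil_of_length_eq_zero hlen, List.prod_nil]
    rw [List.length_map, Finset.length_sort, hcard] at h2
    have h3 := refLength_add_classCount (finRotate d)
    simp only [smul_eq_mul, mul_one] at h2
    omega
  refine ⟨⟨⟨u, hfin⟩, (exists_mem_weightedFactorizations_iff _ _).2
    ⟨_, mul_inv_cancel_left _ _, ?_⟩⟩, rfl⟩
  rw [List.map_map]
  exact hsum _ (GMultiset.pairwise_points ⟨u, hfin⟩)

theorem circleParamI_injective : Function.Injective circleParamI := fun _ _ h =>
  circleParam_injective (congrArg Subtype.val h)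

theorem circleParamI_lt_one (z : Circle) : circleParamI z < 1 :=
  (circleParam_mem z).2

theorem exists_circleParamI_eq {r : unitInterval} (hr : r < 1) : ∃ z, circleParamI z = r :=
  ⟨Circle.exp (2 * Real.pi * r), Subtype.ext (circleParam_exp r.2.1 hr)⟩

theorem LinearFactPoset.circleFun_eq {G : Type*} [Group G] {X : Set G} {g : G}
    {u : LinearFactPoset X g} (hu : u.val 1 = 1) (z : Circle) :
    u.circleFun z = u.val (circleParamI z) := by
  unfold LinearFactPoset.circleFun
  split_ifs with h
  · have : circleParamI z = 0 := Subtype.ext (by simp [circleParamI, circleParam, h])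
    rw [this, hu]
    simp
  · rfl

theorem psi_le_iff {d : ℕ} [NeZero d] {u v : GMultiset Circle (Equiv.Perm (Fin d))} :
    Psi d u ≤ Psi d v ↔ ∀ z, orbitPartition (u.1 z) ≤ orbitPartition (v.1 z) := by
  constructor
  · intro h z a b hab
    have hl := fun a : Fin d => (fiberLabel_fiberPoint (m := a) (circleParam_mem z).1
      (circleParam_mem z).2).1
    have h1 : (Psi d u).1 (fiberPoint d a (circleParam z)) (fiberPoint d b (circleParam z)) := by
      refine ⟨by rw [fiberPoint_pow, fiberPoint_pow], ?_⟩
      rw [fiberPoint_pow, hl, hl]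
      exact hab
    have h2 := (h h1).2
    rw [fiberPoint_pow, hl, hl] at h2
    exact h2
  · exact fun h z w hzw => ⟨hzw.1, h _ hzw.2⟩

theorem orbitPartition_circleFun_le {d : ℕ} {g : Equiv.Perm (Fin d)}
    {v u : LinearFactPoset (transpositions d) g} (h : v ≤ u) (z : Circle) :
    orbitPartition (v.circleFun z) ≤ orbitPartition (u.circleFun z) := by
  unfold LinearFactPoset.circleFun
  split_ifs
  · obtain ⟨h1, h0⟩ := orbitPartition_le_mul u.refLength_circular
    have hv1 := orbitPartition_le_of_prefixLE (prefixLE_conj (h 1) g)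
    have hv0 := orbitPartition_le_of_prefixLE (h 0)
    refine orbitPartition_le fun a => ?_
    rw [Equiv.Perm.mul_apply]
    exact Setoid.trans' _ (h0 (hv0 (orbitPartition_apply _ a))) (h1 (hv1 (orbitPartition_apply _ _)))
  · exact orbitPartition_le_of_prefixLE (h _)

/-- The blocks over all fibers are the orbits of an arc invariant family, which do not cross. -/
theorem isNoncrossing_psi {d : ℕ} [NeZero d]
    (x : CircularFactPoset (transpositions d) (finRotate d)) :
    IsNoncrossing (Psi d x.toMultiset).1 := by
  obtain ⟨u, rfl, hu1⟩ := x.exists_rep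
  obtain ⟨hu, hinc⟩ := u.arcInvariant
  rw [isNoncrossing_iff (DegreePartition.finite_class _)]
  rintro z₁ z₂ w₁ w₂ ⟨hz, hz'⟩ ⟨hw, hw'⟩ h1 h2 h3
  change orbitPartition (u.circleFun (z₁ ^ d)) _ _ at hz'
  change orbitPartition (u.circleFun (w₁ ^ d)) _ _ at hw'
  rw [u.circleFun_eq hu1] at hz' hw'
  rw [circleParam_lt_iff d] at h1 h2 h3
  rw [← hz] at h2 h3
  rw [← hw] at h3
  obtain ⟨h4, h5⟩ := hu.noncrossingFamily hinc _ _ _ _ _ _ hz' hw' h1 h2 h3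
  refine ⟨circleParamI_injective h4, ?_⟩
  change orbitPartition (u.circleFun (z₁ ^ d)) _ _
  rw [u.circleFun_eq hu1]
  exact h5

/-- The multiset of a noncrossing partition takes, at each point, the cyclically increasing
permutation with the blocks of the fiber as orbits. -/
theorem exists_psi_eq {d : ℕ} [NeZero d] (π : NCCircle d) :
    ∃ x : CircularFactPoset (transpositions d) (finRotate d), Psi d x.toMultiset = π.1 := by
  classical
  -- the endpoint `1` is not the parameter of a fiber and gets the trivial partition
  let p : unitInterval → Setoid (Fin d) := fun s =>
    if s < 1 then π.1.1.comap fun m => fiberPoint d m s else ⊥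
  have hp1 : ∀ s, s < 1 → p s = π.1.1.comap fun m => fiberPoint d m s := fun s hs => if_pos hs
  have hp0 : ∀ s, ¬ s < 1 → p s = ⊥ := fun s hs => if_neg hs
  have hnc := (isNoncrossing_iff (DegreePartition.finite_class _)).1 π.2
  have hp : NoncrossingFamily p := by
    intro s r m₁ m₂ n₁ n₂ hm hn h1 h2 h3
    by_cases hs : s < 1
    · by_cases hr : r < 1
      · rw [hp1 s hs] at hm ⊢
        rw [hp1 r hr] at hn
        have hl : ∀ (s : unitInterval) (m : Fin d), s < 1 → toLex (fiberLabel d (fiberPoint d m s),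
            circleParamI (fiberPoint d m s ^ d)) = toLex (m, s) := fun s m hs => by
          obtain ⟨e1, e2⟩ := fiberLabel_fiberPoint (m := m) s.2.1 hs
          rw [e1, show circleParamI (fiberPoint d m s ^ d) = s from Subtype.ext e2]
        have h4 := hnc _ _ _ _ hm hn
          (by rw [circleParam_lt_iff d, hl s _ hs, hl r _ hr]; exact h1)
          (by rw [circleParam_lt_iff d, hl s _ hs, hl r _ hr]; exact h2)
          (by rw [circleParam_lt_iff d, hl s _ hs, hl r _ hr]; exact h3)
        have h5 := π.1.2 _ _ h4
        have h6 : s = r := Subtype.ext (by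
          rw [← (fiberLabel_fiberPoint (m := m₁) s.2.1 hs).2, h5,
            (fiberLabel_fiberPoint (m := n₁) r.2.1 hr).2])
        subst h6
        exact ⟨rfl, h4⟩
      · rw [hp0 r hr] at hn
        have hn' : n₁ = n₂ := hn
        exact absurd (h2.trans h3) (by rw [hn']; exact lt_irrefl _)
    · rw [hp0 s hs] at hm
      have hm' : m₁ = m₂ := hm
      exact absurd (h1.trans h2) (by rw [hm']; exact lt_irrefl _)
  choose u hinc hup using fun s => exists_cyclicallyIncreasing (p s)
  have hu : ArcInvariant u := NoncrossingFamily.arcInvariant (by simpa only [hup] using hp) hinc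
  obtain ⟨v, rfl⟩ := exists_linearFactPoset hu hinc
  have hv1 : v.val 1 = 1 := by
    ext1 a
    have h1 := orbitPartition_apply (v.val 1) a
    rw [hup, hp0 1 (lt_irrefl _)] at h1
    exact (show a = _ from h1).symm
  refine ⟨Quotient.mk _ v, Subtype.ext (Setoid.ext fun z w => ?_)⟩
  change z ^ d = w ^ d ∧ orbitPartition (v.circleFun (z ^ d)) _ _ ↔ _
  rw [v.circleFun_eq hv1, hup, hp1 _ (circleParamI_lt_one _)]
  have hrel : z ^ d = w ^ d → ((π.1.1.comap fun m => fiberPoint d m (circleParamI (z ^ d)))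
      (fiberLabel d z) (fiberLabel d w) ↔ π.1.1 z w) := fun h => by
    rw [Setoid.comap_rel]
    change π.1.1 (fiberPoint d _ (circleParam (z ^ d))) (fiberPoint d _ (circleParam (z ^ d))) ↔ _
    rw [fiberPoint_fiberLabel, h, fiberPoint_fiberLabel]
  exact ⟨fun h => (hrel h.1).1 h.2, fun h => ⟨π.1.2 _ _ h, (hrel (π.1.2 _ _ h)).2 h⟩⟩

theorem le_of_psi_le {d : ℕ} [NeZero d] {x y : CircularFactPoset (transpositions d) (finRotate d)}
    (h : Psi d x.toMultiset ≤ Psi d y.toMultiset) : x ≤ y := by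
  obtain ⟨v, rfl, hv1⟩ := x.exists_rep
  obtain ⟨u, rfl, hu1⟩ := y.exists_rep
  refine ⟨v, u, rfl, rfl, fun r => ?_⟩
  rcases unitInterval.le_one' (t := r) |>.lt_or_eq with hr | rfl
  · obtain ⟨z, rfl⟩ := exists_circleParamI_eq hr
    have h1 : orbitPartition (v.circleFun z) ≤ orbitPartition (u.circleFun z) := psi_le_iff.1 h z
    rw [v.circleFun_eq hv1, u.circleFun_eq hu1] at h1
    exact prefixLE_iff.2 (refLength_add_refLength_inv_mul_le v.arcInvariant.1
      (v.arcInvariant.2 _) (u.arcInvariant.2 _) h1)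
  · rw [hv1, hu1, prefixLE_iff]
    simp [refLength_one]

theorem psi_injective {d : ℕ} [NeZero d] {x y : CircularFactPoset (transpositions d) (finRotate d)}
    (h : Psi d x.toMultiset = Psi d y.toMultiset) : x = y := by
  obtain ⟨v, rfl, hv1⟩ := x.exists_rep
  obtain ⟨u, rfl, hu1⟩ := y.exists_rep
  have hval : ∀ r, v.val r = u.val r := by
    intro r
    rcases unitInterval.le_one' (t := r) |>.lt_or_eq with hr | rfl
    · obtain ⟨z, rfl⟩ := exists_circleParamI_eq hr
      have h1 : orbitPartition (v.circleFun z) = orbitPartition (u.circleFun z) :=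
        le_antisymm (psi_le_iff.1 h.le z) (psi_le_iff.1 h.ge z)
      rw [v.circleFun_eq hv1, u.circleFun_eq hu1] at h1
      exact (v.arcInvariant.2 _).eq_of_orbitPartition_eq (u.arcInvariant.2 _) h1
    · rw [hv1, hu1]
  exact congrArg _ (Subtype.ext (Subtype.ext (funext hval)))

/-- `Ψ` restricts to an isomorphism of posets from `F(Sym_d, δ, S)`, where `δ = (1 2 ⋯ d)`,
onto the degree-`d` noncrossing partitions of the unit circle. -/
theorem theoremA (d : ℕ) [NeZero d] :
    ∃ e : CircularFactPoset (transpositions d) (finRotate d) ≃o NCCircle d,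
      ∀ x, (e x).1 = Psi d x.toMultiset := by
  let f : CircularFactPoset (transpositions d) (finRotate d) → NCCircle d := fun x =>
    ⟨Psi d x.toMultiset, isNoncrossing_psi x⟩
  have hf : Function.Bijective f :=
    ⟨fun x y h => psi_injective (congrArg Subtype.val h), fun π =>
      (exists_psi_eq π).imp fun x hx => Subtype.ext hx⟩
  refine ⟨⟨Equiv.ofBijective f hf, fun {x y} => ⟨fun h => le_of_psi_le h, ?_⟩⟩, fun x => rfl⟩
  rintro ⟨v, u, rfl, rfl, hvu⟩
  exact psi_le_iff.2 (orbitPartition_circleFun_le hvu)
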